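/- **Setting.** Fix two-dimensional defect conditions with a single label for $2$-strata, a set $D_1$ of labels for oriented $1$-strata, a set $D_0$ of labels for $0$-strata (with formal inverses $x^{-1}$, $u^{-1}$), and a map $\psi_{0,1}$ sending each signed label $u^{\pm1}$ to a cyclic sequence $[(x_1^{\epsilon_1},\dots,x_n^{\epsilon_n})]$, where $\psi_{0,1}(u^{-1})$ is the reversed inverted sequence. A *trivial surrounding theory* $T_0^{cw}$ assigns $\mathbb{C}$ to $2$-strata, a finite-dimensional complex vector space $X_x$ to $x\in D_1$ (write $X_x^{+1}=X_x$, $X_x^{-1}=X_x^*$), and to every signed label $u$ with $\psi_{0,1}(u)=[(x_1^{\epsilon_1},\dots,x_n^{\epsilon_n})]$ a cyclically invariant linear form $\mu_u$ on $X_{x_1}^{\epsilon_1}\otimes\cdots\otimes X_{x_n}^{\epsilon_n}$. A *polygonal bordism* $M:U\to V$ is an oriented disc with defects and a PLCW decomposition, whose boundary is divided into four arcs, each consisting of at least one edge: the in-boundary $U$, the out-boundary $V$, and a left and a right side. The sides do not meet the defects; no $0$-cell lies on a defect, every edge meets the $1$-strata in at most one point, and every $2$-cell is of one of three types: (I) it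 contains no defect; (II) it is crossed by exactly one $1$-stratum; (III) it contains exactly one $0$-stratum $u$, joined to each of its edges by one $1$-stratum, the signed labels read anticlockwise being $\psi_{0,1}(u)$ (sign $+$ if oriented towards $u$). Put $R_e=\mathbb{C}$ if the edge $e$ meets no defect and $R_e=X_x^{\epsilon}$ if it meets a defect labelled $x^{\epsilon}$, and $T_0^{cw}(U)=\bigotimes_{e\subset U}R_e$, likewise $T_0^{cw}(V)$. For a $2$-cell $P$ and an edge $e$ of $P$ (with the orientation induced by $P$) put $Q_{(P,e)}=\mathbb{C}$, $X_x$ or $X_x^*$ according as $e$ meets no defect, or a defect labelled $x$ oriented into, respectively out of, $P$; let $Q(M)=\bigotimes_{(P,e),\,e\not\subset U}Q_{(P,e)}$. The propagator $\mathscr P(M):\mathbb{C}\to Q(M)\otimes T_0^{cw}(V)$ is the tensor product over the edges $e\not\subset U$ of the canonical elements $\sum_i v_i\otimes v_i^*$ in the two factors belonging to $e$ (for $e\subset V$ one of them is $R_e$; the element is $1\otimes 1$ if $e$ is interior or in $V$ and meets no defect, and $1\in\mathbb{C}$ if $e$ lies in the left or right side). The evaluation $\mathscr E(M):T_0^{cw}(U)\otimes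 Q(M)\to\mathbb{C}$ is the tensor product over the $2$-cells of: multiplication of scalars for type (I); multiplication of scalars times the pairing $X_x^*\otimes X_x\to\mathbb{C}$ for type (II); $\mu_u$ for type (III). Finally $$T_0^{cw}(M)=(\mathscr E(M)\otimes\mathbf 1)\circ(\mathbf 1\otimes\mathscr P(M)):T_0^{cw}(U)\to T_0^{cw}(V).$$ **Proposition.** Let $M_1:U_1\to V_1$ and $M_2:U_2\to V_2$ be polygonal bordisms. Let $M_1\otimes M_2:U_1\otimes U_2\to V_1\otimes V_2$ be their fusion (horizontal composite): subdivide edges in the sides of $M_1$ and $M_2$ in any way such that the right side of $M_1$ and the left side of $M_2$ get equally many edges, and glue these two sides edge by edge. Then, under the canonical isomorphisms $T_0^{cw}(U_1\otimes U_2)\cong T_0^{cw}(U_1)\otimes T_0^{cw}(U_2)$ and $T_0^{cw}(V_1\otimes V_2)\cong T_0^{cw}(V_1)\otimes T_0^{cw}(V_2)$, $$T_0^{cw}(M_1\otimes M_2)=T_0^{cw}(M_1)\otimes T_0^{cw}(M_2).$$ -/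

import Mathlib

open scoped TensorProduct

noncomputable section

/-! ### Labels and defect conditions -/

/-- `Signed S` is the set `S` together with the formal inverses of its elements. -/
inductive Signed (S : Type*) where
  | of (s : S) : Signed S
  | inv (s : S) : Signed S

/-- The formal inversion `x ↦ x⁻¹` on `Signed S`. -/
def Signed.flip {S : Type*} : Signed S → Signed S
  | .of s => .inv s
  | .inv s => .of s

/-- Two-dimensional defect conditions: labels `D₂`, `D₁`, `D₀` for the strata of dimension
`2`, `1`, `0`, and the maps saying which labels may be adjacent. `Cycle` is the type of finite
sequences up to cyclic permutation. -/
structure DefectData (D₂ D₁ D₀ : Type*) where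
  psi12 : Signed D₁ → D₂ × D₂
  psi01 : Signed D₀ → Cycle (Signed D₁)
  psi12_flip : ∀ x, psi12 x.flip = (psi12 x).swap
  psi01_flip : ∀ u, psi01 u.flip = ((psi01 u).map Signed.flip).reverse

/-- What a `1`-cell can meet: nothing (`none`), or one `1`-stratum, recorded with a sign. -/
abbrev EdgeLabel (D₁ : Type*) := Option (Signed D₁)

/-- The label of an edge seen from its other side. -/
def flipLabel {D₁ : Type*} (a : EdgeLabel D₁) : EdgeLabel D₁ := a.map Signed.flip

/-- A cell-decomposed interval with point defects: finitely many `1`-cells in a row, each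
containing at most one labelled point. It is the part of an object (a circle with defects)
that lies in the polygon under consideration. -/
structure DefectArc (D₁ : Type*) where
  n : ℕ
  lab : Fin n → EdgeLabel D₁

/-- Fusion of objects: juxtaposition. -/
def DefectArc.fuse {D₁ : Type*} (U₁ U₂ : DefectArc D₁) : DefectArc D₁ where
  n := U₁.n + U₂.n
  lab := fun i => Sum.elim U₁.lab U₂.lab (finSumFinEquiv.symm i)

/-! ### Basic-gons -/

/-- The three types of `2`-cells (basic-gons).
* `plain n`: an `n`-gon without defects.
* `strand x n₁ n₂`: one `1`-stratum labelled `x` crosses the polygon. Going anticlockwise one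
  meets the edge where the stratum leaves, `n₁` free edges, the edge where it enters, and `n₂`
  free edges.
* `junction u n a`: an `n`-gon with one `0`-stratum labelled `u` joined to every edge by one
  `1`-stratum; `a` lists the signed labels anticlockwise, the sign being `+` for a stratum
  oriented towards the `0`-stratum. -/
inductive Cell {D₂ D₁ D₀ : Type*} (D : DefectData D₂ D₁ D₀) where
  | plain (n : ℕ) (hn : 0 < n) : Cell D
  | strand (x : D₁) (n₁ n₂ : ℕ) : Cell D
  | junction (u : Signed D₀) (n : ℕ) (hn : 0 < n) (a : Fin n → Signed D₁)
      (ha : D.psi01 u = (List.ofFn a : Cycle (Signed D₁))) : Cell D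

namespace Cell

variable {D₂ D₁ D₀ : Type*} {D : DefectData D₂ D₁ D₀}

/-- The edges of the polygon. -/
def Edge : Cell D → Type
  | plain n _ => Fin n
  | strand _ n₁ n₂ => Unit ⊕ (Fin n₁ ⊕ (Unit ⊕ Fin n₂))
  | junction _ n _ _ _ => Fin n

instance (c : Cell D) : Fintype c.Edge := by
  cases c <;> (unfold Edge; infer_instance)

instance (c : Cell D) : DecidableEq c.Edge := by
  cases c <;> (unfold Edge; infer_instance)

/-- The label of an edge as seen from the polygon: sign `+` if the `1`-stratum is oriented into
the polygon there, sign `-` if it is oriented out of it. -/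
def lab : (c : Cell D) → c.Edge → EdgeLabel D₁
  | plain _ _, _ => none
  | strand x _ _, .inl _ => some (.inv x)
  | strand _ _ _, .inr (.inl _) => none
  | strand x _ _, .inr (.inr (.inl _)) => some (.of x)
  | strand _ _ _, .inr (.inr (.inr _)) => none
  | junction _ _ _ a _, i => some (a i)

/-- The number of edges. -/
def size : Cell D → ℕ
  | plain n _ => n
  | strand _ n₁ n₂ => 1 + (n₁ + (1 + n₂))
  | junction _ n _ _ _ => n

/-- Numbering of the edges in anticlockwise order. -/
def pos : (c : Cell D) → c.Edge ≃ Fin c.size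
  | plain n _ => Equiv.refl (Fin n)
  | strand _ n₁ n₂ =>
      ((Equiv.sumCongr (Equiv.ofUnique Unit (Fin 1))
        ((Equiv.sumCongr (Equiv.refl (Fin n₁))
          ((Equiv.sumCongr (Equiv.ofUnique Unit (Fin 1)) (Equiv.refl (Fin n₂))).trans
            finSumFinEquiv)).trans finSumFinEquiv)).trans finSumFinEquiv :
        (Unit ⊕ (Fin n₁ ⊕ (Unit ⊕ Fin n₂))) ≃ Fin (1 + (n₁ + (1 + n₂))))
  | junction _ n _ _ _ => Equiv.refl (Fin n)

/-- The next edge in anticlockwise order. -/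
def next (c : Cell D) (e : c.Edge) : c.Edge := c.pos.symm (finRotate c.size (c.pos e))

/-- `SubCell c c' π`: the polygon `c'` arises from `c` by subdividing some of its free edges into
consecutive pieces; `π` sends a piece to the edge it comes from. -/
inductive SubCell : (c c' : Cell D) → (c'.Edge → c.Edge) → Prop
  | plain {n n' : ℕ} (hn : 0 < n) (hn' : 0 < n') (π : Fin n' → Fin n)
      (hmono : Monotone π) (hsurj : Function.Surjective π) :
      SubCell (.plain n hn) (.plain n' hn') π
  | strand (x : D₁) {n₁ n₂ n₁' n₂' : ℕ} (π₁ : Fin n₁' → Fin n₁) (π₂ : Fin n₂' → Fin n₂)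
      (hmono₁ : Monotone π₁) (hsurj₁ : Function.Surjective π₁)
      (hmono₂ : Monotone π₂) (hsurj₂ : Function.Surjective π₂) :
      SubCell (.strand x n₁ n₂) (.strand x n₁' n₂')
        (Sum.map id (Sum.map π₁ (Sum.map id π₂)))
  | junction (u : Signed D₀) {n : ℕ} (hn : 0 < n) (a : Fin n → Signed D₁)
      (ha : D.psi01 u = (List.ofFn a : Cycle (Signed D₁))) :
      SubCell (.junction u n hn a ha) (.junction u n hn a ha) id

end Cell

/-! ### Cell-decomposed bordisms -/

/-- The half-edges of a decomposed surface with corners: both sides `fst e`, `snd e` of each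
interior edge `e`, and the one side of each edge in the in-boundary, the out-boundary and the
left and right side. -/
inductive HalfEdge (I : Type) (nIn nOut nLeft nRight : ℕ) where
  | fst (e : I)
  | snd (e : I)
  | inn (i : Fin nIn)
  | out (j : Fin nOut)
  | left (k : Fin nLeft)
  | right (k : Fin nRight)

/-- The half-edges that do not lie in the in-boundary. -/
inductive FreeHalf (I : Type) (nOut nLeft nRight : ℕ) where
  | fst (e : I)
  | snd (e : I)
  | out (j : Fin nOut)
  | left (k : Fin nLeft)
  | right (k : Fin nRight)

/-- A half-edge either lies in the in-boundary or not. -/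
def HalfEdge.split (I : Type) (nIn nOut nLeft nRight : ℕ) :
    Fin nIn ⊕ FreeHalf I nOut nLeft nRight ≃ HalfEdge I nIn nOut nLeft nRight where
  toFun
    | .inl i => .inn i
    | .inr (.fst e) => .fst e
    | .inr (.snd e) => .snd e
    | .inr (.out j) => .out j
    | .inr (.left k) => .left k
    | .inr (.right k) => .right k
  invFun
    | .inn i => .inl i
    | .fst e => .inr (.fst e)
    | .snd e => .inr (.snd e)
    | .out j => .inr (.out j)
    | .left k => .inr (.left k)
    | .right k => .inr (.right k)
  left_inv := by rintro (i | (e | e | j | k | k)) <;> rfl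
  right_inv := by rintro (e | e | i | j | k | k) <;> rfl

/-- A compact oriented surface with defects, glued from basic-gons along their edges, whose
boundary edges are distributed over an in-boundary `U`, an out-boundary `V` and two sides free of
defects. (The labels of the `2`-strata are not recorded: the set `D₂` will have just one element.) The elements of `Σ p, (cell p).Edge` are the triples (polygon, edge, orientation
induced on the edge by the polygon). -/
structure CWBordism {D₂ D₁ D₀ : Type*} (D : DefectData D₂ D₁ D₀) (U V : DefectArc D₁) where
  /-- the `2`-cells -/
  P : Type
  [finP : Fintype P]
  cell : P → Cell D
  /-- the interior `1`-cells -/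
  I : Type
  [finI : Fintype I]
  /-- the label of an interior `1`-cell, seen from its first side -/
  edgeLab : I → EdgeLabel D₁
  nL : ℕ
  nR : ℕ
  /-- which edge of which polygon a half-edge is; this encodes the gluing -/
  inc : HalfEdge I U.n V.n nL nR ≃ (Σ p, (cell p).Edge)
  lab_fst : ∀ e, (cell (inc (.fst e)).1).lab (inc (.fst e)).2 = edgeLab e
  lab_snd : ∀ e, (cell (inc (.snd e)).1).lab (inc (.snd e)).2 = flipLabel (edgeLab e)
  lab_inn : ∀ i, (cell (inc (.inn i)).1).lab (inc (.inn i)).2 = U.lab i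
  lab_out : ∀ j, (cell (inc (.out j)).1).lab (inc (.out j)).2 = flipLabel (V.lab j)
  lab_left : ∀ k, (cell (inc (.left k)).1).lab (inc (.left k)).2 = none
  lab_right : ∀ k, (cell (inc (.right k)).1).lab (inc (.right k)).2 = none

attribute [instance] CWBordism.finP CWBordism.finI

namespace CWBordism

variable {D₂ D₁ D₀ : Type*} {D : DefectData D₂ D₁ D₀} {U V : DefectArc D₁}

/-- The triples (polygon, edge, induced orientation). -/
abbrev Flag (M : CWBordism D U V) : Type := Σ p, (M.cell p).Edge

/-- The label of an edge as seen from the polygon. -/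
abbrev flagLab (M : CWBordism D U V) (f : M.Flag) : EdgeLabel D₁ := (M.cell f.1).lab f.2

/-- The label of a half-edge as seen from the polygon it belongs to. -/
def halfLab (M : CWBordism D U V) : HalfEdge M.I U.n V.n M.nL M.nR → EdgeLabel D₁
  | .fst e => M.edgeLab e
  | .snd e => flipLabel (M.edgeLab e)
  | .inn i => U.lab i
  | .out j => flipLabel (V.lab j)
  | .left _ => none
  | .right _ => none

theorem flagLab_inc (M : CWBordism D U V) (x : HalfEdge M.I U.n V.n M.nL M.nR) :
    M.flagLab (M.inc x) = M.halfLab x := by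
  rcases x with e | e | i | j | k | k
  · exact M.lab_fst e
  · exact M.lab_snd e
  · exact M.lab_inn i
  · exact M.lab_out j
  · exact M.lab_left k
  · exact M.lab_right k

/-- The bijection between half-edges, sorted by whether they lie in the in-boundary, and triples
(polygon, edge, induced orientation). -/
def gatherIdx (M : CWBordism D U V) : Fin U.n ⊕ FreeHalf M.I V.n M.nL M.nR ≃ M.Flag :=
  (HalfEdge.split M.I U.n V.n M.nL M.nR).trans M.inc

theorem gatherIdx_lab (M : CWBordism D U V) (f : M.Flag) :
    M.halfLab (HalfEdge.split M.I U.n V.n M.nL M.nR (M.gatherIdx.symm f)) = M.flagLab f := by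
  rw [← M.flagLab_inc]
  exact congrArg M.flagLab (M.gatherIdx.apply_symm_apply f)

/-- The following edge of the same polygon, anticlockwise. -/
def next (M : CWBordism D U V) (f : M.Flag) : M.Flag := ⟨f.1, (M.cell f.1).next f.2⟩

/-- One gluing of two corners of polygons (a flag stands for the corner at the start of the edge):
the gluing of an interior edge is orientation reversing, so it identifies the start of each of its
sides with the end of the other. -/
inductive CornerStep (M : CWBordism D U V) : M.Flag → M.Flag → Prop
  | fst (e : M.I) : CornerStep M (M.inc (.fst e)) (M.next (M.inc (.snd e)))
  | snd (e : M.I) : CornerStep M (M.inc (.snd e)) (M.next (M.inc (.fst e)))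

/-- The end point of the edge `f` is the starting point of the edge `g`, as `0`-cells of the
glued surface (edges are oriented by their polygons). -/
def Meets (M : CWBordism D U V) (f g : M.Flag) : Prop :=
  Relation.EqvGen M.CornerStep (M.next f) g

/-- Two polygons share an interior edge. -/
def Adjacent (M : CWBordism D U V) (p q : M.P) : Prop :=
  ∃ e, (M.inc (.fst e)).1 = p ∧ (M.inc (.snd e)).1 = q

end CWBordism

/-- A polygonal bordism `U → V`: a cell-decomposed surface with defects that is a disc, with the
shape of a rectangle whose four sides are `U` (bottom), the right side, `V` (top) and the left side.
`U` and `V` are numbered from left to right, the two sides from bottom to top; the boundary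
orientation is anticlockwise.

`connected` and `acyclic` (every cellular `1`-cocycle is a coboundary, i.e. `H¹ = 0`) say that the
surface, which has nonempty boundary, is a disc. -/
structure PolygonalBordism {D₂ D₁ D₀ : Type*} (D : DefectData D₂ D₁ D₀) (U V : DefectArc D₁)
    extends CWBordism D U V where
  pos_in : 0 < U.n
  pos_out : 0 < V.n
  pos_left : 0 < nL
  pos_right : 0 < nR
  connected : ∀ p q, Relation.EqvGen toCWBordism.Adjacent p q
  acyclic : ∀ w : toCWBordism.Flag → ℤ,
    (∀ e, w (inc (.fst e)) + w (inc (.snd e)) = 0) →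
    (∀ p, ∑ e : (cell p).Edge, w ⟨p, e⟩ = 0) →
    ∃ h : toCWBordism.Flag → ℤ,
      (∀ f, w f = h (toCWBordism.next f) - h f) ∧
      (∀ f g, toCWBordism.CornerStep f g → h f = h g)
  meets_in : ∀ i i' : Fin U.n, i.val + 1 = i'.val →
    toCWBordism.Meets (inc (.inn i)) (inc (.inn i'))
  meets_in_right : ∀ (i : Fin U.n) (k : Fin nR), i.val + 1 = U.n → k.val = 0 →
    toCWBordism.Meets (inc (.inn i)) (inc (.right k))
  meets_right : ∀ k k' : Fin nR, k.val + 1 = k'.val →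
    toCWBordism.Meets (inc (.right k)) (inc (.right k'))
  meets_right_out : ∀ (k : Fin nR) (j : Fin V.n), k.val + 1 = nR → j.val + 1 = V.n →
    toCWBordism.Meets (inc (.right k)) (inc (.out j))
  meets_out : ∀ j j' : Fin V.n, j.val + 1 = j'.val →
    toCWBordism.Meets (inc (.out j')) (inc (.out j))
  meets_out_left : ∀ (j : Fin V.n) (k : Fin nL), j.val = 0 → k.val + 1 = nL →
    toCWBordism.Meets (inc (.out j)) (inc (.left k))
  meets_left : ∀ k k' : Fin nL, k.val + 1 = k'.val →
    toCWBordism.Meets (inc (.left k')) (inc (.left k))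
  meets_left_in : ∀ (k : Fin nL) (i : Fin U.n), k.val = 0 → i.val = 0 →
    toCWBordism.Meets (inc (.left k)) (inc (.inn i))

/-! ### Fusion -/

namespace HalfEdge

/-- Half-edges of the fusion: those of both pieces, where the right side of the first piece and the
left side of the second one become the two sides of new interior edges. -/
def fuseEquiv (I₁ I₂ : Type) (u₁ u₂ v₁ v₂ l r r' s : ℕ) (h : r = r') :
    HalfEdge ((I₁ ⊕ I₂) ⊕ Fin r) (u₁ + u₂) (v₁ + v₂) l s ≃
      HalfEdge I₁ u₁ v₁ l r ⊕ HalfEdge I₂ u₂ v₂ r' s where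
  toFun
    | .fst (.inl (.inl e)) => .inl (.fst e)
    | .fst (.inl (.inr e)) => .inr (.fst e)
    | .fst (.inr k) => .inl (.right k)
    | .snd (.inl (.inl e)) => .inl (.snd e)
    | .snd (.inl (.inr e)) => .inr (.snd e)
    | .snd (.inr k) => .inr (.left (Fin.cast h k))
    | .inn i => (finSumFinEquiv.symm i).elim (fun i => .inl (.inn i)) (fun i => .inr (.inn i))
    | .out j => (finSumFinEquiv.symm j).elim (fun j => .inl (.out j)) (fun j => .inr (.out j))
    | .left k => .inl (.left k)
    | .right k => .inr (.right k)
  invFun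
    | .inl (.fst e) => .fst (.inl (.inl e))
    | .inl (.snd e) => .snd (.inl (.inl e))
    | .inl (.inn i) => .inn (finSumFinEquiv (.inl i))
    | .inl (.out j) => .out (finSumFinEquiv (.inl j))
    | .inl (.left k) => .left k
    | .inl (.right k) => .fst (.inr k)
    | .inr (.fst e) => .fst (.inl (.inr e))
    | .inr (.snd e) => .snd (.inl (.inr e))
    | .inr (.inn i) => .inn (finSumFinEquiv (.inr i))
    | .inr (.out j) => .out (finSumFinEquiv (.inr j))
    | .inr (.left k) => .snd (.inr (Fin.cast h.symm k))
    | .inr (.right k) => .right k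
  left_inv := by
    rintro (((e | e) | k) | ((e | e) | k) | i | j | k | k) <;> try rfl
    · obtain ⟨i | i, rfl⟩ := finSumFinEquiv.surjective i <;> simp
    · obtain ⟨j | j, rfl⟩ := finSumFinEquiv.surjective j <;> simp
  right_inv := by
    rintro ((e | e | i | j | k | k) | (e | e | i | j | k | k)) <;> simp

end HalfEdge

namespace CWBordism

variable {D₂ D₁ D₀ : Type*} {D : DefectData D₂ D₁ D₀} {U₁ V₁ U₂ V₂ : DefectArc D₁}

/-- The flags of the fusion are the flags of the two pieces. -/
def flagSum (M₁ : CWBordism D U₁ V₁) (M₂ : CWBordism D U₂ V₂) :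
    M₁.Flag ⊕ M₂.Flag ≃ (Σ p : M₁.P ⊕ M₂.P, (Sum.elim M₁.cell M₂.cell p).Edge) where
  toFun
    | .inl f => ⟨.inl f.1, f.2⟩
    | .inr f => ⟨.inr f.1, f.2⟩
  invFun
    | ⟨.inl p, e⟩ => .inl ⟨p, e⟩
    | ⟨.inr p, e⟩ => .inr ⟨p, e⟩
  left_inv := by rintro (f | f) <;> rfl
  right_inv := by rintro ⟨p | p, e⟩ <;> rfl

/-- The gluing pattern of the fusion. -/
def fuseInc (M₁ : CWBordism D U₁ V₁) (M₂ : CWBordism D U₂ V₂) (h : M₁.nR = M₂.nL) :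
    HalfEdge ((M₁.I ⊕ M₂.I) ⊕ Fin M₁.nR) (U₁.fuse U₂).n (V₁.fuse V₂).n M₁.nL M₂.nR ≃
      (Σ p : M₁.P ⊕ M₂.P, (Sum.elim M₁.cell M₂.cell p).Edge) :=
  (HalfEdge.fuseEquiv M₁.I M₂.I U₁.n U₂.n V₁.n V₂.n M₁.nL M₁.nR M₂.nL M₂.nR h).trans
    ((Equiv.sumCongr M₁.inc M₂.inc).trans (flagSum M₁ M₂))

section
variable (M₁ : CWBordism D U₁ V₁) (M₂ : CWBordism D U₂ V₂) (h : M₁.nR = M₂.nL)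

theorem fuseInc_inn_inl (i : Fin U₁.n) :
    fuseInc M₁ M₂ h (.inn (finSumFinEquiv (.inl i))) =
      ⟨.inl (M₁.inc (.inn i)).1, (M₁.inc (.inn i)).2⟩ := by
  have : HalfEdge.fuseEquiv M₁.I M₂.I U₁.n U₂.n V₁.n V₂.n M₁.nL M₁.nR M₂.nL M₂.nR h
      (.inn (finSumFinEquiv (.inl i))) = .inl (.inn i) := by
    rw [← Equiv.eq_symm_apply]; rfl
  exact congrArg (fun x => flagSum M₁ M₂ (Equiv.sumCongr M₁.inc M₂.inc x)) this

theorem fuseInc_inn_inr (i : Fin U₂.n) :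
    fuseInc M₁ M₂ h (.inn (finSumFinEquiv (.inr i))) =
      ⟨.inr (M₂.inc (.inn i)).1, (M₂.inc (.inn i)).2⟩ := by
  have : HalfEdge.fuseEquiv M₁.I M₂.I U₁.n U₂.n V₁.n V₂.n M₁.nL M₁.nR M₂.nL M₂.nR h
      (.inn (finSumFinEquiv (.inr i))) = .inr (.inn i) := by
    rw [← Equiv.eq_symm_apply]; rfl
  exact congrArg (fun x => flagSum M₁ M₂ (Equiv.sumCongr M₁.inc M₂.inc x)) this

theorem fuseInc_out_inl (j : Fin V₁.n) :
    fuseInc M₁ M₂ h (.out (finSumFinEquiv (.inl j))) =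
      ⟨.inl (M₁.inc (.out j)).1, (M₁.inc (.out j)).2⟩ := by
  have : HalfEdge.fuseEquiv M₁.I M₂.I U₁.n U₂.n V₁.n V₂.n M₁.nL M₁.nR M₂.nL M₂.nR h
      (.out (finSumFinEquiv (.inl j))) = .inl (.out j) := by
    rw [← Equiv.eq_symm_apply]; rfl
  exact congrArg (fun x => flagSum M₁ M₂ (Equiv.sumCongr M₁.inc M₂.inc x)) this

theorem fuseInc_out_inr (j : Fin V₂.n) :
    fuseInc M₁ M₂ h (.out (finSumFinEquiv (.inr j))) =
      ⟨.inr (M₂.inc (.out j)).1, (M₂.inc (.out j)).2⟩ := by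
  have : HalfEdge.fuseEquiv M₁.I M₂.I U₁.n U₂.n V₁.n V₂.n M₁.nL M₁.nR M₂.nL M₂.nR h
      (.out (finSumFinEquiv (.inr j))) = .inr (.out j) := by
    rw [← Equiv.eq_symm_apply]; rfl
  exact congrArg (fun x => flagSum M₁ M₂ (Equiv.sumCongr M₁.inc M₂.inc x)) this

end

/-- Fusion (horizontal composite) of two decomposed bordisms: glue the right side of the first
edge by edge to the left side of the second. -/
def fuse (M₁ : CWBordism D U₁ V₁) (M₂ : CWBordism D U₂ V₂) (h : M₁.nR = M₂.nL) :
    CWBordism D (U₁.fuse U₂) (V₁.fuse V₂) where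
  P := M₁.P ⊕ M₂.P
  cell := Sum.elim M₁.cell M₂.cell
  I := (M₁.I ⊕ M₂.I) ⊕ Fin M₁.nR
  edgeLab := Sum.elim (Sum.elim M₁.edgeLab M₂.edgeLab) (fun _ => none)
  nL := M₁.nL
  nR := M₂.nR
  inc := fuseInc M₁ M₂ h
  lab_fst := by
    rintro ((e | e) | k)
    · exact M₁.lab_fst e
    · exact M₂.lab_fst e
    · exact M₁.lab_right k
  lab_snd := by
    rintro ((e | e) | k)
    · exact M₁.lab_snd e
    · exact M₂.lab_snd e
    · exact M₂.lab_left _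
  lab_inn := by
    intro i
    obtain ⟨i | i, rfl⟩ := finSumFinEquiv.surjective i
    · rw [fuseInc_inn_inl]
      simpa [DefectArc.fuse] using M₁.lab_inn i
    · rw [fuseInc_inn_inr]
      simpa [DefectArc.fuse] using M₂.lab_inn i
  lab_out := by
    intro j
    obtain ⟨j | j, rfl⟩ := finSumFinEquiv.surjective j
    · rw [fuseInc_out_inl]
      simpa [DefectArc.fuse] using M₁.lab_out j
    · rw [fuseInc_out_inr]
      simpa [DefectArc.fuse] using M₂.lab_out j
  lab_left := M₁.lab_left
  lab_right := M₂.lab_right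

section
variable (M₁ : CWBordism D U₁ V₁) (M₂ : CWBordism D U₂ V₂) (h : M₁.nR = M₂.nL)

/-- The flags of the first piece in the fusion. -/
def flagInl (f : M₁.Flag) : (M₁.fuse M₂ h).Flag := ⟨.inl f.1, f.2⟩

/-- The flags of the second piece in the fusion. -/
def flagInr (f : M₂.Flag) : (M₁.fuse M₂ h).Flag := ⟨.inr f.1, f.2⟩

theorem fuse_inc_inn_inl (i : Fin U₁.n) :
    (M₁.fuse M₂ h).inc (.inn (finSumFinEquiv (.inl i))) = M₁.flagInl M₂ h (M₁.inc (.inn i)) :=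
  fuseInc_inn_inl M₁ M₂ h _

theorem fuse_inc_inn_inr (i : Fin U₂.n) :
    (M₁.fuse M₂ h).inc (.inn (finSumFinEquiv (.inr i))) = M₁.flagInr M₂ h (M₂.inc (.inn i)) :=
  fuseInc_inn_inr M₁ M₂ h _

theorem fuse_inc_out_inl (j : Fin V₁.n) :
    (M₁.fuse M₂ h).inc (.out (finSumFinEquiv (.inl j))) = M₁.flagInl M₂ h (M₁.inc (.out j)) :=
  fuseInc_out_inl M₁ M₂ h _

theorem fuse_inc_out_inr (j : Fin V₂.n) :
    (M₁.fuse M₂ h).inc (.out (finSumFinEquiv (.inr j))) = M₁.flagInr M₂ h (M₂.inc (.out j)) :=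
  fuseInc_out_inr M₁ M₂ h _

theorem meets_congr {U V : DefectArc D₁} (M : CWBordism D U V) {f g f' g' : M.Flag} (hf : f = f')
    (hg : g = g') (s : M.Meets f' g') : M.Meets f g := by
  subst hf hg; exact s

theorem cornerStep_inl {f g : M₁.Flag} (s : M₁.CornerStep f g) :
    (M₁.fuse M₂ h).CornerStep (M₁.flagInl M₂ h f) (M₁.flagInl M₂ h g) := by
  cases s with
  | fst e => exact CornerStep.fst (M := M₁.fuse M₂ h) (.inl (.inl e))
  | snd e => exact CornerStep.snd (M := M₁.fuse M₂ h) (.inl (.inl e))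

theorem cornerStep_inr {f g : M₂.Flag} (s : M₂.CornerStep f g) :
    (M₁.fuse M₂ h).CornerStep (M₁.flagInr M₂ h f) (M₁.flagInr M₂ h g) := by
  cases s with
  | fst e => exact CornerStep.fst (M := M₁.fuse M₂ h) (.inl (.inr e))
  | snd e => exact CornerStep.snd (M := M₁.fuse M₂ h) (.inl (.inr e))

theorem corner_inl {f g : M₁.Flag} (s : Relation.EqvGen M₁.CornerStep f g) :
    Relation.EqvGen (M₁.fuse M₂ h).CornerStep (M₁.flagInl M₂ h f) (M₁.flagInl M₂ h g) := by
  induction s with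
  | rel _ _ s => exact .rel _ _ (cornerStep_inl M₁ M₂ h s)
  | refl => exact .refl _
  | symm _ _ _ ih => exact .symm _ _ ih
  | trans _ _ _ _ _ ih ih' => exact .trans _ _ _ ih ih'

theorem corner_inr {f g : M₂.Flag} (s : Relation.EqvGen M₂.CornerStep f g) :
    Relation.EqvGen (M₁.fuse M₂ h).CornerStep (M₁.flagInr M₂ h f) (M₁.flagInr M₂ h g) := by
  induction s with
  | rel _ _ s => exact .rel _ _ (cornerStep_inr M₁ M₂ h s)
  | refl => exact .refl _
  | symm _ _ _ ih => exact .symm _ _ ih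
  | trans _ _ _ _ _ ih ih' => exact .trans _ _ _ ih ih'

theorem meets_inl {f g : M₁.Flag} (s : M₁.Meets f g) :
    (M₁.fuse M₂ h).Meets (M₁.flagInl M₂ h f) (M₁.flagInl M₂ h g) := corner_inl M₁ M₂ h s

theorem meets_inr {f g : M₂.Flag} (s : M₂.Meets f g) :
    (M₁.fuse M₂ h).Meets (M₁.flagInr M₂ h f) (M₁.flagInr M₂ h g) := corner_inr M₁ M₂ h s

theorem corner_right_left (k : Fin M₁.nR) :
    (M₁.fuse M₂ h).CornerStep (M₁.flagInl M₂ h (M₁.inc (.right k)))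
      ((M₁.fuse M₂ h).next (M₁.flagInr M₂ h (M₂.inc (.left (Fin.cast h k))))) :=
  CornerStep.fst (M := M₁.fuse M₂ h) (.inr k)

theorem corner_left_right (k : Fin M₁.nR) :
    (M₁.fuse M₂ h).CornerStep (M₁.flagInr M₂ h (M₂.inc (.left (Fin.cast h k))))
      ((M₁.fuse M₂ h).next (M₁.flagInl M₂ h (M₁.inc (.right k)))) :=
  CornerStep.snd (M := M₁.fuse M₂ h) (.inr k)

end

end CWBordism

namespace PolygonalBordism

variable {D₂ D₁ D₀ : Type*} {D : DefectData D₂ D₁ D₀} {U₁ V₁ U₂ V₂ : DefectArc D₁}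

theorem const_of_corner {U V : DefectArc D₁} (M : CWBordism D U V) (h : M.Flag → ℤ)
    (hh : ∀ f g, M.CornerStep f g → h f = h g) {f g : M.Flag}
    (s : Relation.EqvGen M.CornerStep f g) : h f = h g := by
  induction s with
  | rel _ _ s => exact hh _ _ s
  | refl => rfl
  | symm _ _ _ ih => exact ih.symm
  | trans _ _ _ _ _ ih ih' => exact ih.trans ih'

theorem fuse_connected (M₁ : PolygonalBordism D U₁ V₁) (M₂ : PolygonalBordism D U₂ V₂)
    (h : M₁.nR = M₂.nL) (p q : (M₁.toCWBordism.fuse M₂.toCWBordism h).P) :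
    Relation.EqvGen (M₁.toCWBordism.fuse M₂.toCWBordism h).Adjacent p q := by
  let M := M₁.toCWBordism.fuse M₂.toCWBordism h
  have h1 : ∀ p q : M₁.P, Relation.EqvGen M.Adjacent (.inl p) (.inl q) := by
    intro p q
    have := M₁.connected p q
    induction this with
    | rel _ _ s =>
      obtain ⟨e, h1, h2⟩ := s
      exact .rel _ _ ⟨.inl (.inl e), congrArg Sum.inl h1, congrArg Sum.inl h2⟩
    | refl => exact .refl _
    | symm _ _ _ ih => exact .symm _ _ ih
    | trans _ _ _ _ _ ih ih' => exact .trans _ _ _ ih ih'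
  have h2 : ∀ p q : M₂.P, Relation.EqvGen M.Adjacent (.inr p) (.inr q) := by
    intro p q
    have := M₂.connected p q
    induction this with
    | rel _ _ s =>
      obtain ⟨e, h1, h2⟩ := s
      exact .rel _ _ ⟨.inl (.inr e), congrArg Sum.inr h1, congrArg Sum.inr h2⟩
    | refl => exact .refl _
    | symm _ _ _ ih => exact .symm _ _ ih
    | trans _ _ _ _ _ ih ih' => exact .trans _ _ _ ih ih'
  have h3 : ∀ (p : M₁.P) (q : M₂.P), Relation.EqvGen M.Adjacent (.inl p) (.inr q) := by
    intro p q
    refine .trans _ _ _ (h1 p (M₁.inc (.right ⟨0, M₁.pos_right⟩)).1) ?_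
    refine .trans _ _ _ (.rel _ _ ⟨.inr ⟨0, M₁.pos_right⟩, rfl, rfl⟩) (h2 _ q)
  exact match p, q with
    | .inl p, .inl q => h1 p q
    | .inl p, .inr q => h3 p q
    | .inr p, .inl q => .symm _ _ (h3 q p)
    | .inr p, .inr q => h2 p q

theorem fuse_acyclic (M₁ : PolygonalBordism D U₁ V₁) (M₂ : PolygonalBordism D U₂ V₂)
    (h : M₁.nR = M₂.nL) (w : (M₁.toCWBordism.fuse M₂.toCWBordism h).Flag → ℤ)
    (hw : ∀ e, w ((M₁.toCWBordism.fuse M₂.toCWBordism h).inc (.fst e)) +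
      w ((M₁.toCWBordism.fuse M₂.toCWBordism h).inc (.snd e)) = 0)
    (hp : ∀ p, ∑ e : ((M₁.toCWBordism.fuse M₂.toCWBordism h).cell p).Edge, w ⟨p, e⟩ = 0) :
    ∃ g : (M₁.toCWBordism.fuse M₂.toCWBordism h).Flag → ℤ,
      (∀ f, w f = g ((M₁.toCWBordism.fuse M₂.toCWBordism h).next f) - g f) ∧
      (∀ f f', (M₁.toCWBordism.fuse M₂.toCWBordism h).CornerStep f f' → g f = g f') := by
  obtain ⟨g₁, hg₁, hc₁⟩ := M₁.acyclic (fun f => w (M₁.flagInl M₂.toCWBordism h f))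
    (fun e => hw (.inl (.inl e))) (fun p => hp (.inl p))
  obtain ⟨g₂, hg₂, hc₂⟩ := M₂.acyclic (fun f => w (M₁.flagInr M₂.toCWBordism h f))
    (fun e => hw (.inl (.inr e))) (fun p => hp (.inr p))
  let d : Fin M₁.nR → ℤ := fun k =>
    g₁ (M₁.inc (.right k)) - g₂ (M₂.next (M₂.inc (.left (Fin.cast h k))))
  have hd : ∀ k, d k = g₁ (M₁.next (M₁.inc (.right k))) - g₂ (M₂.inc (.left (Fin.cast h k))) := by
    intro k
    have a := hg₁ (M₁.inc (.right k))
    have b := hg₂ (M₂.inc (.left (Fin.cast h k)))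
    have c : w (M₁.flagInl M₂.toCWBordism h (M₁.inc (.right k))) +
      w (M₁.flagInr M₂.toCWBordism h (M₂.inc (.left (Fin.cast h k)))) = 0 := hw (.inr k)
    simp only [d]
    linarith
  have hstep : ∀ k k' : Fin M₁.nR, k.val + 1 = k'.val → d k = d k' := by
    intro k k' hk
    have a := const_of_corner _ g₁ hc₁ (M₁.meets_right k k' hk)
    have b := const_of_corner _ g₂ hc₂
      (M₂.meets_left (Fin.cast h k) (Fin.cast h k') (by simpa using hk))
    rw [hd k]
    simp only [d]
    rw [a, b]
  have hconst : ∀ (m : ℕ) (hm : m < M₁.nR), d ⟨m, hm⟩ = d ⟨0, M₁.pos_right⟩ := by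
    intro m
    induction m with
    | zero => intro _; rfl
    | succ m ih => intro hm; rw [← ih (by omega)]; exact (hstep _ _ rfl).symm
  have hconst' : ∀ k, d k = d ⟨0, M₁.pos_right⟩ := fun k => hconst k.val k.isLt
  refine ⟨fun f => match f with
    | ⟨.inl p, e⟩ => g₁ ⟨p, e⟩
    | ⟨.inr p, e⟩ => g₂ ⟨p, e⟩ + d ⟨0, M₁.pos_right⟩, ?_, ?_⟩
  · rintro ⟨p | p, e⟩
    · exact hg₁ ⟨p, e⟩
    · refine (hg₂ ⟨p, e⟩).trans ?_
      change _ = (g₂ (M₂.next ⟨p, e⟩) + d ⟨0, M₁.pos_right⟩) - (g₂ ⟨p, e⟩ + d ⟨0, M₁.pos_right⟩)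
      ring
  · intro f f' s
    cases s with
    | fst e =>
      rcases e with (e | e) | k
      · exact hc₁ _ _ (.fst e)
      · exact congrArg (· + d ⟨0, M₁.pos_right⟩) (hc₂ _ _ (.fst e))
      · change g₁ (M₁.inc (.right k)) =
          g₂ (M₂.next (M₂.inc (.left (Fin.cast h k)))) + d ⟨0, M₁.pos_right⟩
        rw [← hconst' k]
        simp only [d]
        ring
    | snd e =>
      rcases e with (e | e) | k
      · exact hc₁ _ _ (.snd e)
      · exact congrArg (· + d ⟨0, M₁.pos_right⟩) (hc₂ _ _ (.snd e))
      · change g₂ (M₂.inc (.left (Fin.cast h k))) + d ⟨0, M₁.pos_right⟩ =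
          g₁ (M₁.next (M₁.inc (.right k)))
        rw [← hconst' k, hd k]
        ring

/-- Fusion of polygonal bordisms whose common side is decomposed into equally many edges. -/
def fuse (M₁ : PolygonalBordism D U₁ V₁) (M₂ : PolygonalBordism D U₂ V₂) (h : M₁.nR = M₂.nL) :
    PolygonalBordism D (U₁.fuse U₂) (V₁.fuse V₂) where
  toCWBordism := M₁.toCWBordism.fuse M₂.toCWBordism h
  pos_in := Nat.add_pos_left M₁.pos_in _
  pos_out := Nat.add_pos_left M₁.pos_out _
  pos_left := M₁.pos_left
  pos_right := M₂.pos_right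
  connected := fuse_connected M₁ M₂ h
  acyclic := fuse_acyclic M₁ M₂ h
  meets_in := by
    intro i i' hi
    obtain ⟨i | i, rfl⟩ := finSumFinEquiv.surjective i <;>
      obtain ⟨i' | i', rfl⟩ := finSumFinEquiv.surjective i' <;>
      simp only [finSumFinEquiv_apply_left, finSumFinEquiv_apply_right, Fin.val_castAdd,
        Fin.val_natAdd] at hi
    · exact CWBordism.meets_congr _ (CWBordism.fuse_inc_inn_inl _ _ h i) (CWBordism.fuse_inc_inn_inl _ _ h i')
        (CWBordism.meets_inl _ _ h (M₁.meets_in i i' hi))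
    · have hi1 : i.val + 1 = U₁.n := by omega
      have hi2 : i'.val = 0 := by omega
      have a := CWBordism.meets_inl M₁.toCWBordism M₂.toCWBordism h
        (M₁.meets_in_right i ⟨0, M₁.pos_right⟩ hi1 rfl)
      have b := CWBordism.meets_inr M₁.toCWBordism M₂.toCWBordism h
        (M₂.meets_left_in (Fin.cast h ⟨0, M₁.pos_right⟩) i' rfl hi2)
      exact CWBordism.meets_congr _ (CWBordism.fuse_inc_inn_inl _ _ h i) (CWBordism.fuse_inc_inn_inr _ _ h i')
        (.trans _ _ _ a (.trans _ _ _
          (.rel _ _ (CWBordism.corner_right_left M₁.toCWBordism M₂.toCWBordism h _)) b))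
    · omega
    · exact CWBordism.meets_congr _ (CWBordism.fuse_inc_inn_inr _ _ h i) (CWBordism.fuse_inc_inn_inr _ _ h i')
        (CWBordism.meets_inr _ _ h (M₂.meets_in i i' (by omega)))
  meets_in_right := by
    intro i k hi hk
    obtain ⟨i | i, rfl⟩ := finSumFinEquiv.surjective i <;>
      simp only [DefectArc.fuse, finSumFinEquiv_apply_left, finSumFinEquiv_apply_right, Fin.val_castAdd,
        Fin.val_natAdd] at hi
    · have := M₂.pos_in; omega
    · exact CWBordism.meets_congr _ (CWBordism.fuse_inc_inn_inr _ _ h i) rfl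
        (CWBordism.meets_inr _ _ h (M₂.meets_in_right i k (by omega) hk))
  meets_right := fun k k' hk => CWBordism.meets_inr _ _ h (M₂.meets_right k k' hk)
  meets_right_out := by
    intro k j hk hj
    obtain ⟨j | j, rfl⟩ := finSumFinEquiv.surjective j <;>
      simp only [DefectArc.fuse, finSumFinEquiv_apply_left, finSumFinEquiv_apply_right, Fin.val_castAdd,
        Fin.val_natAdd] at hj
    · have := M₂.pos_out; omega
    · exact CWBordism.meets_congr _ rfl (CWBordism.fuse_inc_out_inr _ _ h j)
        (CWBordism.meets_inr _ _ h (M₂.meets_right_out k j hk (by omega)))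
  meets_out := by
    intro j j' hj
    obtain ⟨j | j, rfl⟩ := finSumFinEquiv.surjective j <;>
      obtain ⟨j' | j', rfl⟩ := finSumFinEquiv.surjective j' <;>
      simp only [finSumFinEquiv_apply_left, finSumFinEquiv_apply_right, Fin.val_castAdd,
        Fin.val_natAdd] at hj
    · exact CWBordism.meets_congr _ (CWBordism.fuse_inc_out_inl _ _ h j') (CWBordism.fuse_inc_out_inl _ _ h j)
        (CWBordism.meets_inl _ _ h (M₁.meets_out j j' hj))
    · have hj1 : j.val + 1 = V₁.n := by omega
      have hj2 : j'.val = 0 := by omega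
      have hpos := M₁.pos_right
      let k : Fin M₁.nR := ⟨M₁.nR - 1, by omega⟩
      have hk : k.val + 1 = M₁.nR := by simp only [k]; omega
      have a := CWBordism.meets_inr M₁.toCWBordism M₂.toCWBordism h
        (M₂.meets_out_left j' (Fin.cast h k) hj2 (by simpa [← h] using hk))
      have b := CWBordism.meets_inl M₁.toCWBordism M₂.toCWBordism h
        (M₁.meets_right_out k j hk hj1)
      exact CWBordism.meets_congr _ (CWBordism.fuse_inc_out_inr _ _ h j') (CWBordism.fuse_inc_out_inl _ _ h j)
        (.trans _ _ _ a (.trans _ _ _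
          (.rel _ _ (CWBordism.corner_left_right M₁.toCWBordism M₂.toCWBordism h _)) b))
    · omega
    · exact CWBordism.meets_congr _ (CWBordism.fuse_inc_out_inr _ _ h j') (CWBordism.fuse_inc_out_inr _ _ h j)
        (CWBordism.meets_inr _ _ h (M₂.meets_out j j' (by omega)))
  meets_out_left := by
    intro j k hj hk
    obtain ⟨j | j, rfl⟩ := finSumFinEquiv.surjective j <;>
      simp only [finSumFinEquiv_apply_left, finSumFinEquiv_apply_right, Fin.val_castAdd,
        Fin.val_natAdd] at hj
    · exact CWBordism.meets_congr _ (CWBordism.fuse_inc_out_inl _ _ h j) rfl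
        (CWBordism.meets_inl _ _ h (M₁.meets_out_left j k hj hk))
    · have := M₁.pos_out; omega
  meets_left := fun k k' hk => CWBordism.meets_inl _ _ h (M₁.meets_left k k' hk)
  meets_left_in := by
    intro k i hk hi
    obtain ⟨i | i, rfl⟩ := finSumFinEquiv.surjective i <;>
      simp only [finSumFinEquiv_apply_left, finSumFinEquiv_apply_right, Fin.val_castAdd,
        Fin.val_natAdd] at hi
    · exact CWBordism.meets_congr _ rfl (CWBordism.fuse_inc_inn_inl _ _ h i)
        (CWBordism.meets_inl _ _ h (M₁.meets_left_in k i hk hi))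
    · have := M₁.pos_in; omega

end PolygonalBordism

/-! ### Subdividing the sides -/

/-- `SideSubdivision M M'`: the decomposition `M'` of the same surface with defects arises from `M`
by subdividing edges of the left and right sides, everything else being unchanged. -/
structure SideSubdivision {D₂ D₁ D₀ : Type*} {D : DefectData D₂ D₁ D₀} {U V : DefectArc D₁}
    (M M' : CWBordism D U V) where
  onP : M'.P ≃ M.P
  onI : M'.I ≃ M.I
  /-- the edge of which an edge of `M'` is a piece -/
  onEdge : ∀ p, (M'.cell p).Edge → (M.cell (onP p)).Edge
  onLeft : Fin M'.nL → Fin M.nL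
  onRight : Fin M'.nR → Fin M.nR
  subCell : ∀ p, Cell.SubCell (M.cell (onP p)) (M'.cell p) (onEdge p)
  edgeLab_onI : ∀ e, M.edgeLab (onI e) = M'.edgeLab e
  left_mono : Monotone onLeft
  left_surj : Function.Surjective onLeft
  right_mono : Monotone onRight
  right_surj : Function.Surjective onRight
  inc_fst : ∀ e, M.inc (.fst (onI e)) =
    ⟨onP (M'.inc (.fst e)).1, onEdge _ (M'.inc (.fst e)).2⟩
  inc_snd : ∀ e, M.inc (.snd (onI e)) =
    ⟨onP (M'.inc (.snd e)).1, onEdge _ (M'.inc (.snd e)).2⟩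
  inc_inn : ∀ i, M.inc (.inn i) = ⟨onP (M'.inc (.inn i)).1, onEdge _ (M'.inc (.inn i)).2⟩
  inc_out : ∀ j, M.inc (.out j) = ⟨onP (M'.inc (.out j)).1, onEdge _ (M'.inc (.out j)).2⟩
  inc_left : ∀ k, M.inc (.left (onLeft k)) =
    ⟨onP (M'.inc (.left k)).1, onEdge _ (M'.inc (.left k)).2⟩
  inc_right : ∀ k, M.inc (.right (onRight k)) =
    ⟨onP (M'.inc (.right k)).1, onEdge _ (M'.inc (.right k)).2⟩

/-! ### Trivial surrounding theories -/

/-- A finite-dimensional complex vector space for every label of a `1`-stratum. -/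
structure WallSpaces (D₁ : Type*) where
  space : D₁ → Type
  [addCommGroup : ∀ x, AddCommGroup (space x)]
  [module : ∀ x, Module ℂ (space x)]
  [finite : ∀ x, FiniteDimensional ℂ (space x)]

attribute [instance] WallSpaces.addCommGroup WallSpaces.module WallSpaces.finite

namespace WallSpaces

variable {D₁ : Type*} (X : WallSpaces D₁)

/-- `X_x` for `x`, and its dual for `x⁻¹`. -/
def signed : Signed D₁ → Type
  | .of x => X.space x
  | .inv x => Module.Dual ℂ (X.space x)

instance (a : Signed D₁) : AddCommGroup (X.signed a) := by
  cases a <;> (unfold signed; infer_instance)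

instance (a : Signed D₁) : Module ℂ (X.signed a) := by
  cases a
  · exact (inferInstance : Module ℂ (X.space _))
  · exact (inferInstance : Module ℂ (Module.Dual ℂ (X.space _)))

/-- The vector space of an edge label: `ℂ` for an edge without defect. -/
def edge : EdgeLabel D₁ → Type
  | none => ℂ
  | some a => X.signed a

instance (a : EdgeLabel D₁) : AddCommGroup (X.edge a) := by
  cases a
  · exact (inferInstance : AddCommGroup ℂ)
  · exact (inferInstance : AddCommGroup (X.signed _))

instance (a : EdgeLabel D₁) : Module ℂ (X.edge a) := by
  cases a
  · exact (inferInstance : Module ℂ ℂ)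
  · exact (inferInstance : Module ℂ (X.signed _))

/-- `X.edge` of an unlabelled edge is `ℂ`. -/
def scalar : X.edge none ≃ₗ[ℂ] ℂ := LinearEquiv.refl ℂ ℂ

/-- `X.edge` of an edge labelled `a` is `X.signed a`. -/
def toSigned (a : Signed D₁) : X.edge (some a) ≃ₗ[ℂ] X.signed a := LinearEquiv.refl ℂ _

/-- `X.signed x` is `X_x`. -/
def toSpace (x : D₁) : X.signed (.of x) ≃ₗ[ℂ] X.space x := LinearEquiv.refl ℂ _

/-- `X.signed x⁻¹` is the dual of `X_x`. -/
def toDual (x : D₁) : X.signed (.inv x) ≃ₗ[ℂ] Module.Dual ℂ (X.space x) := LinearEquiv.refl ℂ _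

/-- Transport along an equality of labels. -/
def edgeCast {a b : EdgeLabel D₁} (h : a = b) : X.edge a ≃ₗ[ℂ] X.edge b := by
  subst h; exact LinearEquiv.refl ℂ _

/-- The tensor product of the spaces of the edges of an object. -/
abbrev obj (U : DefectArc D₁) : Type := ⨂[ℂ] i : Fin U.n, X.edge (U.lab i)

/-- The canonical isomorphism `T(U₁) ⊗ T(U₂) ≅ T(U₁ ⊗ U₂)`: concatenation of tensors. -/
def objFuse (U₁ U₂ : DefectArc D₁) :
    (X.obj U₁ ⊗[ℂ] X.obj U₂) ≃ₗ[ℂ] X.obj (U₁.fuse U₂) :=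
  (PiTensorProduct.tmulEquivDep ℂ (fun i => X.edge (Sum.elim U₁.lab U₂.lab i))).trans
    (PiTensorProduct.reindex ℂ (fun i => X.edge (Sum.elim U₁.lab U₂.lab i)) finSumFinEquiv)

/-- Index set of a basis of `X.edge a` (for `ℂ`, the basis `{1}`). -/
def Idx : EdgeLabel D₁ → Type
  | none => Unit
  | some (.of x) => Fin (Module.finrank ℂ (X.space x))
  | some (.inv x) => Fin (Module.finrank ℂ (X.space x))

instance (a : EdgeLabel D₁) : Fintype (X.Idx a) := by
  rcases a with _ | (x | x) <;> (unfold Idx; infer_instance)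

/-- A basis of `X.edge a`. -/
def vec : (a : EdgeLabel D₁) → X.Idx a → X.edge a
  | none, _ => (1 : ℂ)
  | some (.of x), i => Module.finBasis ℂ (X.space x) i
  | some (.inv x), i => (Module.finBasis ℂ (X.space x)).coord i

/-- The dual basis, in `X.edge a⁻¹`. -/
def covec : (a : EdgeLabel D₁) → X.Idx a → X.edge (flipLabel a)
  | none, _ => (1 : ℂ)
  | some (.of x), i => (Module.finBasis ℂ (X.space x)).coord i
  | some (.inv x), i => Module.finBasis ℂ (X.space x) i

end WallSpaces

/-- The data of a trivial surrounding theory: the field `ℂ` for the only label of `2`-strata,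
a vector space for every label of a `1`-stratum, and for every signed label `u` of a `0`-stratum a
linear form on `X_{a₁} ⊗ ⋯ ⊗ X_{aₙ}` for `psi01 u = [(a₁, …, aₙ)]`, compatible with cyclic
rotations. (It is given for every linear ordering of the cyclic sequence; compatibility makes it
determined by one ordering, for which it is invariant under the rotations fixing it.) -/
structure TrivialTheory {D₂ D₁ D₀ : Type*} [Unique D₂] (D : DefectData D₂ D₁ D₀) extends
    WallSpaces D₁ where
  mu : ∀ (u : Signed D₀) (n : ℕ) (a : Fin n → Signed D₁),
    D.psi01 u = (List.ofFn a : Cycle (Signed D₁)) →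
      ((⨂[ℂ] i, toWallSpaces.signed (a i)) →ₗ[ℂ] ℂ)
  mu_rotate : ∀ (u : Signed D₀) (n : ℕ) (a : Fin n → Signed D₁)
    (ha : D.psi01 u = (List.ofFn a : Cycle (Signed D₁)))
    (ha' : D.psi01 u = (List.ofFn (fun i => a (finRotate n i)) : Cycle (Signed D₁)))
    (v : ∀ i, toWallSpaces.signed (a i)),
    mu u n (fun i => a (finRotate n i)) ha' (PiTensorProduct.tprod ℂ fun i => v (finRotate n i)) =
      mu u n a ha (PiTensorProduct.tprod ℂ v)

namespace TrivialTheory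

variable {D₂ D₁ D₀ : Type*} [Unique D₂] {D : DefectData D₂ D₁ D₀} (T : TrivialTheory D)

/-- The evaluation of a tensor of vectors at a basic-gon: the product of the scalars for `plain`;
the scalars times `⟨v*, w⟩` for `strand`, where `v*` sits at the exit and `w` at the entrance; the
given linear form for `junction`. -/
def evalFun : (c : Cell D) → (∀ e : c.Edge, T.edge (c.lab e)) → ℂ
  | .plain n _, v => ∏ i : Fin n, T.scalar (v i)
  | .strand x n₁ n₂, v =>
      (∏ i : Fin n₁, T.scalar (v (.inr (.inl i)))) *
        T.toDual x (T.toSigned _ (v (.inl ())))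
          (T.toSpace x (T.toSigned _ (v (.inr (.inr (.inl ())))))) *
        ∏ i : Fin n₂, T.scalar (v (.inr (.inr (.inr i))))
  | .junction u n _ a ha, v =>
      T.mu u n a ha (PiTensorProduct.tprod ℂ fun i : Fin n => T.toSigned (a i) (v i))

theorem evalFun_strand_update (x : D₁) (n₁ n₂ : ℕ) [DecidableEq (Cell.strand x n₁ n₂ : Cell D).Edge]
    (v : ∀ e : (Cell.strand x n₁ n₂ : Cell D).Edge, T.edge ((Cell.strand x n₁ n₂).lab e))
    (i : (Cell.strand x n₁ n₂ : Cell D).Edge) :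
    ∃ L : T.edge ((Cell.strand x n₁ n₂ : Cell D).lab i) →ₗ[ℂ] ℂ,
      ∀ y, T.evalFun (.strand x n₁ n₂) (Function.update v i y) = L y := by
  set A := ∏ i : Fin n₁, T.scalar (v (.inr (.inl i))) with hA
  set B := ∏ i : Fin n₂, T.scalar (v (.inr (.inr (.inr i)))) with hB
  set φ := T.toDual x (T.toSigned _ (v (.inl ()))) with hφ
  set w := T.toSpace x (T.toSigned _ (v (.inr (.inr (.inl ()))))) with hw
  rcases i with i | i | i | i
  · refine ⟨(A * B) • ((Module.Dual.eval ℂ (T.space x) w).comp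
      ((T.toSigned (.inv x)).trans (T.toDual x)).toLinearMap), ?_⟩
    intro y
    have h1 : Function.update v (.inl i) y (.inl ()) = y := Function.update_self ..
    have h2 : ∀ e, Function.update v (.inl i) y (.inr e) = v (.inr e) :=
      fun e => Function.update_of_ne (by exact Sum.inr_ne_inl) ..
    simp only [evalFun, h1, h2]
    exact mul_right_comm _ _ _
  · refine ⟨(φ w * B) • (((MultilinearMap.mkPiAlgebra ℂ (Fin n₁) ℂ).toLinearMap
          (fun i => T.scalar (v (.inr (.inl i)))) i).comp T.scalar.toLinearMap), ?_⟩
    intro y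
    have h1 : Function.update v (.inr (.inl i)) y (.inl ()) = v (.inl ()) :=
      Function.update_of_ne (by exact Sum.inl_ne_inr) ..
    have h2 : ∀ e, Function.update v (.inr (.inl i)) y (.inr (.inr e)) = v (.inr (.inr e)) :=
      fun e => Function.update_of_ne (by exact fun h => Sum.inr_ne_inl (Sum.inr.inj h)) ..
    have h3 : (∏ k : Fin n₁, T.scalar (Function.update v (.inr (.inl i)) y (.inr (.inl k)))) =
        ∏ k : Fin n₁, Function.update (fun k => T.scalar (v (.inr (.inl k)))) i (T.scalar y) k := by
      refine Finset.prod_congr rfl fun k _ => ?_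
      by_cases hk : k = i
      · subst hk
        rw [Function.update_self]
        exact congrArg T.scalar (Function.update_self ..)
      · rw [Function.update_of_ne hk]
        exact congrArg T.scalar
          (Function.update_of_ne (by exact fun h => hk (Sum.inl.inj (Sum.inr.inj h))) ..)
    simp only [evalFun, h1, h2, h3]
    rw [mul_assoc, mul_comm]
    rfl
  · refine ⟨(A * B) • (φ.comp ((T.toSigned (.of x)).trans (T.toSpace x)).toLinearMap), ?_⟩
    intro y
    have h1 : Function.update v (.inr (.inr (.inl i))) y (.inl ()) = v (.inl ()) :=
      Function.update_of_ne (by exact Sum.inl_ne_inr) ..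
    have h2 : ∀ e, Function.update v (.inr (.inr (.inl i))) y (.inr (.inl e)) = v (.inr (.inl e)) :=
      fun e => Function.update_of_ne (by exact fun h => Sum.inl_ne_inr (Sum.inr.inj h)) ..
    have h3 : ∀ e, Function.update v (.inr (.inr (.inl i))) y (.inr (.inr (.inr e))) =
        v (.inr (.inr (.inr e))) :=
      fun e => Function.update_of_ne
        (by exact fun h => Sum.inr_ne_inl (Sum.inr.inj (Sum.inr.inj h))) ..
    have h4 : Function.update v (.inr (.inr (.inl i))) y (.inr (.inr (.inl ()))) = y :=
      Function.update_self ..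
    simp only [evalFun, h1, h2, h3, h4]
    exact mul_right_comm _ _ _
  · refine ⟨(A * φ w) • (((MultilinearMap.mkPiAlgebra ℂ (Fin n₂) ℂ).toLinearMap
          (fun i => T.scalar (v (.inr (.inr (.inr i))))) i).comp T.scalar.toLinearMap), ?_⟩
    intro y
    have h1 : Function.update v (.inr (.inr (.inr i))) y (.inl ()) = v (.inl ()) :=
      Function.update_of_ne (by exact Sum.inl_ne_inr) ..
    have h2 : ∀ e, Function.update v (.inr (.inr (.inr i))) y (.inr (.inl e)) = v (.inr (.inl e)) :=
      fun e => Function.update_of_ne (by exact fun h => Sum.inl_ne_inr (Sum.inr.inj h)) ..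
    have h4 : Function.update v (.inr (.inr (.inr i))) y (.inr (.inr (.inl ()))) =
        v (.inr (.inr (.inl ()))) :=
      Function.update_of_ne (by exact fun h => Sum.inl_ne_inr (Sum.inr.inj (Sum.inr.inj h))) ..
    have h3 : (∏ k : Fin n₂,
        T.scalar (Function.update v (.inr (.inr (.inr i))) y (.inr (.inr (.inr k))))) =
        ∏ k : Fin n₂,
          Function.update (fun k => T.scalar (v (.inr (.inr (.inr k))))) i (T.scalar y) k := by
      refine Finset.prod_congr rfl fun k _ => ?_
      by_cases hk : k = i
      · subst hk
        rw [Function.update_self]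
        exact congrArg T.scalar (Function.update_self ..)
      · rw [Function.update_of_ne hk]
        exact congrArg T.scalar (Function.update_of_ne
          (by exact fun h => hk (Sum.inr.inj (Sum.inr.inj (Sum.inr.inj h)))) ..)
    simp only [evalFun, h1, h2, h3, h4]
    rfl

theorem evalFun_plain_update (n : ℕ) (hn : 0 < n) [DecidableEq (Cell.plain n hn : Cell D).Edge]
    (v : ∀ e : (Cell.plain n hn : Cell D).Edge, T.edge ((Cell.plain n hn).lab e))
    (i : (Cell.plain n hn : Cell D).Edge) :
    ∃ L : T.edge ((Cell.plain n hn : Cell D).lab i) →ₗ[ℂ] ℂ,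
      ∀ y, T.evalFun (.plain n hn) (Function.update v i y) = L y := by
  refine ⟨((MultilinearMap.mkPiAlgebra ℂ (Fin n) ℂ).toLinearMap
    (fun i => T.scalar (v i)) i).comp T.scalar.toLinearMap, ?_⟩
  intro y
  have h3 : (∏ k : Fin n, T.scalar (Function.update v i y k)) =
      ∏ k : Fin n, Function.update (fun k : Fin n => T.scalar (v k)) i (T.scalar y) k := by
    refine Finset.prod_congr rfl fun k _ => ?_
    by_cases hk : k = i
    · subst hk
      rw [Function.update_self]
      exact congrArg T.scalar (Function.update_self ..)
    · rw [Function.update_of_ne hk]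
      exact congrArg T.scalar (Function.update_of_ne (by exact hk) ..)
  simp only [evalFun, h3]
  rfl

theorem evalFun_junction_update (u : Signed D₀) (n : ℕ) (hn : 0 < n) (a : Fin n → Signed D₁)
    (ha : D.psi01 u = (List.ofFn a : Cycle (Signed D₁)))
    [DecidableEq (Cell.junction u n hn a ha : Cell D).Edge]
    (v : ∀ e : (Cell.junction u n hn a ha : Cell D).Edge,
      T.edge ((Cell.junction u n hn a ha).lab e))
    (i : (Cell.junction u n hn a ha : Cell D).Edge) :
    ∃ L : T.edge ((Cell.junction u n hn a ha : Cell D).lab i) →ₗ[ℂ] ℂ,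
      ∀ y, T.evalFun (.junction u n hn a ha) (Function.update v i y) = L y := by
  refine ⟨(((T.mu u n a ha).compMultilinearMap (PiTensorProduct.tprod ℂ)).toLinearMap
    (fun i => T.toSigned (a i) (v i)) i).comp (T.toSigned (a i)).toLinearMap, ?_⟩
  intro y
  have h3 : (fun k : Fin n => T.toSigned (a k) (Function.update v i y k)) =
      Function.update (fun k : Fin n => T.toSigned (a k) (v k)) i (T.toSigned (a i) y) := by
    funext k
    by_cases hk : k = i
    · subst hk
      rw [Function.update_self]
      exact congrArg (T.toSigned _) (Function.update_self ..)
    · rw [Function.update_of_ne hk]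
      exact congrArg (T.toSigned _) (Function.update_of_ne (by exact hk) ..)
  simp only [evalFun, h3]
  rfl

theorem evalFun_update (c : Cell D) [DecidableEq c.Edge] (v : ∀ e : c.Edge, T.edge (c.lab e))
    (i : c.Edge) : ∃ L : T.edge (c.lab i) →ₗ[ℂ] ℂ,
      ∀ y, T.evalFun c (Function.update v i y) = L y := by
  cases c with
  | plain n hn => exact T.evalFun_plain_update n hn v i
  | strand x n₁ n₂ => exact T.evalFun_strand_update x n₁ n₂ v i
  | junction u n hn a ha => exact T.evalFun_junction_update u n hn a ha v i

section

variable {U V : DefectArc D₁} (M : CWBordism D U V)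

theorem evalFlags_update [DecidableEq M.Flag] (v : ∀ f : M.Flag, T.edge (M.flagLab f))
    (i : M.Flag) : ∃ L : T.edge (M.flagLab i) →ₗ[ℂ] ℂ,
      ∀ y, ∏ p, T.evalFun (M.cell p) (fun e => Function.update v i y ⟨p, e⟩) = L y := by
  classical
  obtain ⟨p₀, e₀⟩ := i
  obtain ⟨L, hL⟩ := T.evalFun_update (M.cell p₀) (fun e => v ⟨p₀, e⟩) e₀
  refine ⟨(∏ p ∈ Finset.univ.erase p₀, T.evalFun (M.cell p) (fun e => v ⟨p, e⟩)) • L, ?_⟩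
  intro y
  rw [← Finset.prod_erase_mul _ _ (Finset.mem_univ p₀)]
  have h1 : (fun e => Function.update v ⟨p₀, e₀⟩ y ⟨p₀, e⟩) =
      Function.update (fun e => v ⟨p₀, e⟩) e₀ y := by
    funext e
    by_cases he : e = e₀
    · subst he
      rw [Function.update_self, Function.update_self]
    · rw [Function.update_of_ne he, Function.update_of_ne]
      intro h
      exact he (eq_of_heq (Sigma.mk.inj h).2)
  rw [h1, hL]
  refine congrArg₂ (· * ·) (Finset.prod_congr rfl fun p hp => ?_) rfl
  congr 1
  funext e
  rw [Function.update_of_ne]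
  intro h
  exact (Finset.ne_of_mem_erase hp) (Sigma.mk.inj h).1

/-- The product over all polygons of the evaluations `evalFun`, as a multilinear map in the vectors
attached to the triples (polygon, edge, orientation). -/
def evalFlags : MultilinearMap ℂ (fun f : M.Flag => T.edge (M.flagLab f)) ℂ where
  toFun v := ∏ p, T.evalFun (M.cell p) (fun e => v ⟨p, e⟩)
  map_update_add' := by
    intro _ v i y z
    obtain ⟨L, hL⟩ := T.evalFlags_update M v i
    rw [hL, hL, hL, map_add]
  map_update_smul' := by
    intro _ v i t y
    obtain ⟨L, hL⟩ := T.evalFlags_update M v i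
    rw [hL, hL, map_smul]

/-- The tensor product `Q(M)` of the spaces of all triples (polygon, edge, orientation) whose edge
is not in the in-boundary. An edge in one of the two sides contributes one factor `ℂ`. -/
abbrev Q : Type :=
  ⨂[ℂ] r : FreeHalf M.I V.n M.nL M.nR,
    T.edge (M.halfLab (HalfEdge.split M.I U.n V.n M.nL M.nR (.inr r)))

/-- `T(U) ⊗ Q(M)` is the tensor product over all triples (polygon, edge, orientation). -/
def gather : (T.obj U ⊗[ℂ] T.Q M) ≃ₗ[ℂ] (⨂[ℂ] f : M.Flag, T.edge (M.flagLab f)) :=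
  ((PiTensorProduct.tmulEquivDep ℂ (fun x : Fin U.n ⊕ FreeHalf M.I V.n M.nL M.nR =>
      T.edge (M.halfLab (HalfEdge.split M.I U.n V.n M.nL M.nR x)))).trans
    (PiTensorProduct.reindex ℂ (fun x : Fin U.n ⊕ FreeHalf M.I V.n M.nL M.nR =>
      T.edge (M.halfLab (HalfEdge.split M.I U.n V.n M.nL M.nR x))) M.gatherIdx)).trans
    (PiTensorProduct.congr fun f => T.edgeCast (M.gatherIdx_lab f))

/-- The evaluation `E(M) : T(U) ⊗ Q(M) → ℂ`, the tensor product of the evaluations of the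
polygons. -/
def evaluation : (T.obj U ⊗[ℂ] T.Q M) →ₗ[ℂ] ℂ :=
  PiTensorProduct.lift (T.evalFlags M) ∘ₗ (T.gather M).toLinearMap

/-- The factors in `Q(M)` of one summand of the propagator. -/
def freeVec (c : ∀ e : M.I, T.Idx (M.edgeLab e)) (d : ∀ j : Fin V.n, T.Idx (V.lab j)) :
    ∀ r : FreeHalf M.I V.n M.nL M.nR,
      T.edge (M.halfLab (HalfEdge.split M.I U.n V.n M.nL M.nR (.inr r)))
  | .fst e => T.vec (M.edgeLab e) (c e)
  | .snd e => T.covec (M.edgeLab e) (c e)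
  | .out j => T.covec (V.lab j) (d j)
  | .left _ => T.scalar.symm 1
  | .right _ => T.scalar.symm 1

open Classical in
/-- The image of `1` under the propagator. The propagator is the tensor product, over all edges not
in the in-boundary, of the elements `∑ᵢ vᵢ ⊗ vᵢ*` (basis and dual basis) in the two factors
belonging to the edge; for an edge of the out-boundary one of the two factors is in `T(V)`; for an
edge in one of the two sides the element is `1 ∈ ℂ`. Here this product of sums is multiplied out. -/
def propagatorElt : T.Q M ⊗[ℂ] T.obj V :=
  ∑ c : ∀ e : M.I, T.Idx (M.edgeLab e), ∑ d : ∀ j : Fin V.n, T.Idx (V.lab j),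
    (PiTensorProduct.tprod ℂ (T.freeVec M c d)) ⊗ₜ[ℂ]
      (PiTensorProduct.tprod ℂ fun j => T.vec (V.lab j) (d j))

/-- The propagator `P(M) : ℂ → Q(M) ⊗ T(V)`. -/
def propagator : ℂ →ₗ[ℂ] T.Q M ⊗[ℂ] T.obj V :=
  LinearMap.toSpanSingleton ℂ _ (T.propagatorElt M)

/-- The value `T(M) : T(U) → T(V)` of the theory on `M`: the composite of
`1 ⊗ P(M) : T(U) → T(U) ⊗ Q(M) ⊗ T(V)` and `E(M) ⊗ 1 : T(U) ⊗ Q(M) ⊗ T(V) → T(V)`. -/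
def onBordism : T.obj U →ₗ[ℂ] T.obj V :=
  (TensorProduct.lid ℂ (T.obj V)).toLinearMap ∘ₗ
    (T.evaluation M).rTensor (T.obj V) ∘ₗ
    (TensorProduct.assoc ℂ (T.obj U) (T.Q M) (T.obj V)).symm.toLinearMap ∘ₗ
    (T.propagator M).lTensor (T.obj U) ∘ₗ
    (TensorProduct.rid ℂ (T.obj U)).symm.toLinearMap

end

end TrivialTheory

end

/-! On a pure tensor the theory is a state sum. For vectors `u` on the in-boundary, `T.onBordism M`
of their tensor product is the sum over basis indices `c` at the interior edges and `d` at the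
out-edges of a number times the basis tensor of `d`. The number is the product over all polygons of
their evaluations on the vectors at their edges (`onBordism_tprod`). Pure tensors determine a linear
map, so it suffices to compare state sums.

Fusion: the edges created by gluing meet no defect. Their space is `ℂ` with the single basis vector
`1`, so they add no summation index, and the states of the fusion are pairs of states of the two
pieces. A polygon cannot detect the gluing: at a side edge it was fed the scalar `1`, and at the
glued edge it is fed the basis vector, or dual basis vector, `1` of `ℂ`. The weight of a pair is
therefore the product of the two weights (`evalFlags_fuse`), and the sum of products is the tensor
product of the two sums (`onBordism_fuse`).

Subdivision of the sides: interior edges and out-edges are unchanged, hence so are the states. An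
edge cut into several pieces lies in a side, carries `1` and enters its polygon only as a scalar
factor, so repeating the factor is harmless (`onBordism_sideSubdivision`).

The space at an edge depends on its label, and the labels of one edge in two descriptions often
agree only propositionally. Vectors are thus compared by `HEq`, which becomes equality inside a
polygon, where the labels coincide definitionally. -/

noncomputable section

/-! ### Pure tensors on objects and their concatenation -/

namespace WallSpaces

variable {D₁ : Type*} (X : WallSpaces D₁)

/-- Transport along an equality of labels disappears under `HEq`; this keeps casts out of all later
comparisons. -/
theorem edgeCast_heq {a b : EdgeLabel D₁} (h : a = b) (x : X.edge a) : X.edgeCast h x ≍ x := by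
  subst h; rfl

/-- The juxtaposition of families of vectors on two objects. -/
def fuseVec {U₁ U₂ : DefectArc D₁} (u₁ : ∀ i, X.edge (U₁.lab i)) (u₂ : ∀ i, X.edge (U₂.lab i)) :
    ∀ i, X.edge ((U₁.fuse U₂).lab i) :=
  fun i => Sum.rec (motive := fun i => X.edge (Sum.elim U₁.lab U₂.lab i)) u₁ u₂
    (finSumFinEquiv.symm i)

/-- `objFuse` is a merging of two families followed by a reindexing, and both send pure tensors to
pure tensors. -/
theorem objFuse_tmul_tprod {U₁ U₂ : DefectArc D₁} (u₁ : ∀ i, X.edge (U₁.lab i))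
    (u₂ : ∀ i, X.edge (U₂.lab i)) :
    X.objFuse U₁ U₂ (PiTensorProduct.tprod ℂ u₁ ⊗ₜ[ℂ] PiTensorProduct.tprod ℂ u₂) =
      PiTensorProduct.tprod ℂ (X.fuseVec u₁ u₂) := by
  have h := PiTensorProduct.tmulEquivDep_apply ℂ (fun i => X.edge (Sum.elim U₁.lab U₂.lab i)) u₁ u₂
  refine (congrArg (PiTensorProduct.reindex ℂ
    (fun i => X.edge (Sum.elim U₁.lab U₂.lab i)) finSumFinEquiv) h).trans ?_
  exact PiTensorProduct.reindex_tprod finSumFinEquiv _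

/-- Only heterogeneous equality is available: the label of the fused object at this position reduces
to `U₁.lab i` only after rewriting with `finSumFinEquiv.symm_apply_apply`. -/
theorem fuseVec_inl {U₁ U₂ : DefectArc D₁} (u₁ : ∀ i, X.edge (U₁.lab i))
    (u₂ : ∀ i, X.edge (U₂.lab i)) (i : Fin U₁.n) :
    X.fuseVec u₁ u₂ (finSumFinEquiv (.inl i)) ≍ u₁ i :=
  congr_arg_heq (Sum.rec (motive := fun i => X.edge (Sum.elim U₁.lab U₂.lab i)) u₁ u₂)
    (finSumFinEquiv.symm_apply_apply (.inl i))

theorem fuseVec_inr {U₁ U₂ : DefectArc D₁} (u₁ : ∀ i, X.edge (U₁.lab i))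
    (u₂ : ∀ i, X.edge (U₂.lab i)) (i : Fin U₂.n) :
    X.fuseVec u₁ u₂ (finSumFinEquiv (.inr i)) ≍ u₂ i :=
  congr_arg_heq (Sum.rec (motive := fun i => X.edge (Sum.elim U₁.lab U₂.lab i)) u₁ u₂)
    (finSumFinEquiv.symm_apply_apply (.inr i))

end WallSpaces

/-! ### The value on a pure tensor as a state sum -/

namespace TrivialTheory

variable {D₂ D₁ D₀ : Type*} [Unique D₂] {D : DefectData D₂ D₁ D₀} (T : TrivialTheory D)

section

variable {U V : DefectArc D₁} (M : CWBordism D U V)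

/-- The vectors at all half-edges: `u` on the in-boundary, one summand of the propagator on the
other ones. -/
def halfVec (u : ∀ i, T.edge (U.lab i)) (c : ∀ e : M.I, T.Idx (M.edgeLab e))
    (d : ∀ j : Fin V.n, T.Idx (V.lab j)) :
    ∀ x : HalfEdge M.I U.n V.n M.nL M.nR, T.edge (M.halfLab x)
  | .fst e => T.vec (M.edgeLab e) (c e)
  | .snd e => T.covec (M.edgeLab e) (c e)
  | .inn i => u i
  | .out j => T.covec (V.lab j) (d j)
  | .left _ => T.scalar.symm 1
  | .right _ => T.scalar.symm 1

/-- The vectors `halfVec`, indexed by the triples (polygon, edge, orientation). -/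
def flagVec (u : ∀ i, T.edge (U.lab i)) (c : ∀ e : M.I, T.Idx (M.edgeLab e))
    (d : ∀ j : Fin V.n, T.Idx (V.lab j)) (f : M.Flag) : T.edge (M.flagLab f) :=
  T.edgeCast (M.gatherIdx_lab f)
    (T.halfVec M u c d (HalfEdge.split M.I U.n V.n M.nL M.nR (M.gatherIdx.symm f)))

/-- Every flag is `M.inc x` for a half-edge `x`, so this reduces statements about the vectors at
flags to a case distinction over the kinds of half-edges. -/
theorem flagVec_inc (u : ∀ i, T.edge (U.lab i)) (c : ∀ e : M.I, T.Idx (M.edgeLab e))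
    (d : ∀ j : Fin V.n, T.Idx (V.lab j)) (x : HalfEdge M.I U.n V.n M.nL M.nR) :
    T.flagVec M u c d (M.inc x) ≍ T.halfVec M u c d x := by
  refine (T.edgeCast_heq _ _).trans ?_
  have h : HalfEdge.split M.I U.n V.n M.nL M.nR (M.gatherIdx.symm (M.inc x)) = x := by
    simp [CWBordism.gatherIdx]
  rw [h]

/-- `gather` concatenates, reindexes along `gatherIdx` and transports labels factor by factor; each
of the three preserves pure tensors. -/
theorem gather_tmul_tprod (u : ∀ i, T.edge (U.lab i)) (c : ∀ e : M.I, T.Idx (M.edgeLab e))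
    (d : ∀ j : Fin V.n, T.Idx (V.lab j)) :
    T.gather M (PiTensorProduct.tprod ℂ u ⊗ₜ[ℂ] PiTensorProduct.tprod ℂ (T.freeVec M c d)) =
      PiTensorProduct.tprod ℂ (T.flagVec M u c d) := by
  have h := PiTensorProduct.tmulEquivDep_apply ℂ
    (fun x : Fin U.n ⊕ FreeHalf M.I V.n M.nL M.nR =>
      T.edge (M.halfLab (HalfEdge.split M.I U.n V.n M.nL M.nR x))) u (T.freeVec M c d)
  let E := PiTensorProduct.congr fun f => T.edgeCast (M.gatherIdx_lab f)
  refine (congrArg (fun t => E (PiTensorProduct.reindex ℂ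
    (fun x : Fin U.n ⊕ FreeHalf M.I V.n M.nL M.nR =>
      T.edge (M.halfLab (HalfEdge.split M.I U.n V.n M.nL M.nR x))) M.gatherIdx t)) h).trans ?_
  refine (congrArg E (PiTensorProduct.reindex_tprod M.gatherIdx _)).trans ?_
  refine (PiTensorProduct.congr_tprod _ _).trans ?_
  congr 1
  funext f
  unfold flagVec
  congr 1
  -- `freeVec` and `halfVec` are given by separate case distinctions, so they agree definitionally
  -- only once the kind of half-edge is known.
  rcases M.gatherIdx.symm f with i | (e | e | j | k | k) <;> rfl

-- The state sum: the propagator is already a multiplied-out sum of pure tensors, and the evaluation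
-- turns each summand, together with `u`, into a scalar weight.
open Classical in
theorem onBordism_tprod (u : ∀ i, T.edge (U.lab i)) :
    T.onBordism M (PiTensorProduct.tprod ℂ u) =
      ∑ c : ∀ e : M.I, T.Idx (M.edgeLab e), ∑ d : ∀ j : Fin V.n, T.Idx (V.lab j),
        T.evalFlags M (T.flagVec M u c d) •
          PiTensorProduct.tprod ℂ fun j => T.vec (V.lab j) (d j) := by
  unfold onBordism
  simp only [LinearMap.comp_apply, LinearEquiv.coe_coe, TensorProduct.rid_symm_apply,
    LinearMap.lTensor_tmul, propagator, LinearMap.toSpanSingleton_apply, one_smul, propagatorElt,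
    TensorProduct.tmul_sum, map_sum, TensorProduct.assoc_symm_tmul, LinearMap.rTensor_tmul,
    TensorProduct.lid_tmul, evaluation, gather_tmul_tprod, PiTensorProduct.lift.tprod]

end

end TrivialTheory

/-! ### Invariance under subdivision of the sides -/

/-- A section `σ` of `π` picks one point in each fibre, and these points alone reproduce the product
over `β`. A point `a` outside the range of `σ` shares its fibre with the different point `σ (π a)`,
so its factor is `1`. -/
theorem Fintype.prod_eq_prod_of_surjective {α β R : Type*} [Fintype α] [Fintype β] [CommMonoid R]
    {π : α → β} (hπ : Function.Surjective π) {f' : α → R} {f : β → R} (hf' : ∀ a, f' a = f (π a))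
    (hf : ∀ a a', a ≠ a' → π a = π a' → f (π a) = 1) : ∏ a, f' a = ∏ b, f b := by
  obtain ⟨σ, hσ⟩ := hπ.hasRightInverse
  refine (Fintype.prod_of_injective σ hσ.injective _ _ (fun a ha => ?_) fun b => ?_).symm
  · exact (hf' a).trans (hf a (σ (π a)) (fun h => ha ⟨_, h.symm⟩) (hσ _).symm)
  · rw [hf', hσ b]

namespace HalfEdge

variable {I I' : Type} {u v l l' r r' : ℕ}

/-- The map on half-edges induced by maps on interior edges and on the edges of the two sides. -/
def mapSides (f : I' → I) (g : Fin l' → Fin l) (h : Fin r' → Fin r) :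
    HalfEdge I' u v l' r' → HalfEdge I u v l r
  | .fst e => .fst (f e)
  | .snd e => .snd (f e)
  | .inn i => .inn i
  | .out j => .out j
  | .left k => .left (g k)
  | .right k => .right (h k)

/-- In- and out-edges are fixed and interior edges are mapped injectively, so collisions can occur
only in the two sides. -/
theorem mapSides_eq_side {f : I' → I} (hf : Function.Injective f) (g : Fin l' → Fin l)
    (h : Fin r' → Fin r) {x y : HalfEdge I' u v l' r'} (hxy : x ≠ y)
    (he : mapSides f g h x = mapSides f g h y) :
    (∃ k, mapSides f g h x = .left k) ∨ ∃ k, mapSides f g h x = .right k := by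
  cases x <;> cases y <;> simp_all [mapSides, hf.eq_iff]

end HalfEdge

namespace SideSubdivision

variable {D₂ D₁ D₀ : Type*} {D : DefectData D₂ D₁ D₀} {U V : DefectArc D₁}
  {M M' : CWBordism D U V} (s : SideSubdivision M M')

/-- The flag of which a flag of the subdivision is a piece. -/
def onFlag (f : M'.Flag) : M.Flag := ⟨s.onP f.1, s.onEdge f.1 f.2⟩

/-- The half-edge of which a half-edge of the subdivision is a piece. -/
def onHalf : HalfEdge M'.I U.n V.n M'.nL M'.nR → HalfEdge M.I U.n V.n M.nL M.nR :=
  HalfEdge.mapSides s.onI s.onLeft s.onRight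

/-- Compatibility of the subdivision with the gluing, for all kinds of half-edges at once. -/
theorem inc_onHalf (x : HalfEdge M'.I U.n V.n M'.nL M'.nR) :
    M.inc (s.onHalf x) = s.onFlag (M'.inc x) := by
  rcases x with e | e | i | j | k | k
  · exact s.inc_fst e
  · exact s.inc_snd e
  · exact s.inc_inn i
  · exact s.inc_out j
  · exact s.inc_left k
  · exact s.inc_right k

end SideSubdivision

namespace TrivialTheory

variable {D₂ D₁ D₀ : Type*} [Unique D₂] {D : DefectData D₂ D₁ D₀} (T : TrivialTheory D)

/-- Only free edges are cut, and these enter the evaluation as scalar factors. A free edge of the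
in-boundary may carry any scalar, which would be raised to a power if repeated; hence `hs` requires
the value `1` at every edge with at least two pieces. -/
theorem evalFun_subCell {c c' : Cell D} {π : c'.Edge → c.Edge} (s : Cell.SubCell c c' π)
    (v : ∀ e, T.edge (c.lab e)) (v' : ∀ e, T.edge (c'.lab e)) (hv : ∀ e, v' e ≍ v (π e))
    (hs : ∀ e e', e ≠ e' → π e = π e' → v (π e) ≍ T.scalar.symm 1) :
    T.evalFun c' v' = T.evalFun c v := by
  cases s with
  | plain hn hn' π hmono hsurj =>
    exact Fintype.prod_eq_prod_of_surjective hsurj (f := fun i => T.scalar (v i))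
      (fun i => congrArg T.scalar (eq_of_heq (hv i)))
      fun a a' h1 h2 => congrArg T.scalar (eq_of_heq (hs a a' h1 h2))
  | strand x π₁ π₂ hmono₁ hsurj₁ hmono₂ hsurj₂ =>
    have h1 : v' (.inl ()) = v (.inl ()) := eq_of_heq (hv (.inl ()))
    have h2 : v' (.inr (.inr (.inl ()))) = v (.inr (.inr (.inl ()))) :=
      eq_of_heq (hv (.inr (.inr (.inl ()))))
    refine congrArg₂ (· * ·) (congrArg₂ (· * ·) ?_ ?_) ?_
    · exact Fintype.prod_eq_prod_of_surjective hsurj₁ (f := fun i => T.scalar (v (.inr (.inl i))))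
        (fun i => congrArg T.scalar (eq_of_heq (hv (.inr (.inl i)))))
        fun a a' h1 h2 => congrArg T.scalar (eq_of_heq (hs (.inr (.inl a)) (.inr (.inl a'))
          (fun h => h1 (Sum.inl.inj (Sum.inr.inj h)))
          (congrArg (fun i => Sum.inr (Sum.inl i)) h2)))
    · exact congrArg₂ (fun a b => T.toDual x (T.toSigned _ a) (T.toSpace x (T.toSigned _ b))) h1 h2
    · exact Fintype.prod_eq_prod_of_surjective hsurj₂
        (f := fun i => T.scalar (v (.inr (.inr (.inr i)))))
        (fun i => congrArg T.scalar (eq_of_heq (hv (.inr (.inr (.inr i))))))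
        fun a a' h1 h2 => congrArg T.scalar (eq_of_heq
          (hs (.inr (.inr (.inr a))) (.inr (.inr (.inr a')))
            (fun h => h1 (Sum.inr.inj (Sum.inr.inj (Sum.inr.inj h))))
            (congrArg (fun i => Sum.inr (Sum.inr (Sum.inr i))) h2)))
  | junction u hn a ha =>
    -- A junction has no free edges, so here the polygon is unchanged and `π` is the identity.
    exact congrArg (T.evalFun _) (funext fun e => eq_of_heq (hv e))

section

variable {U V : DefectArc D₁} {M M' : CWBordism D U V} (s : SideSubdivision M M')

/-- Basis indices at the interior edges of a decomposition and of a subdivision of its sides. -/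
def idxEquiv : (∀ e : M'.I, T.Idx (M'.edgeLab e)) ≃ ∀ e : M.I, T.Idx (M.edgeLab e) :=
  (Equiv.piCongrRight fun e => Equiv.cast (congrArg T.Idx (s.edgeLab_onI e).symm)).trans
    (Equiv.piCongrLeft (fun e => T.Idx (M.edgeLab e)) s.onI)

theorem idxEquiv_heq (c : ∀ e : M'.I, T.Idx (M'.edgeLab e)) (e : M'.I) :
    c e ≍ T.idxEquiv s c (s.onI e) := by
  unfold idxEquiv
  rw [Equiv.trans_apply, Equiv.piCongrLeft_apply_apply]
  exact (cast_heq _ _).symm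

theorem vec_heq {a b : EdgeLabel D₁} (h : a = b) {i : T.Idx a} {j : T.Idx b} (hij : i ≍ j) :
    T.vec a i ≍ T.vec b j := by
  subst h; subst hij; rfl

theorem covec_heq {a b : EdgeLabel D₁} (h : a = b) {i : T.Idx a} {j : T.Idx b} (hij : i ≍ j) :
    T.covec a i ≍ T.covec b j := by
  subst h; subst hij; rfl

theorem halfVec_onHalf (u : ∀ i, T.edge (U.lab i)) (c : ∀ e : M'.I, T.Idx (M'.edgeLab e))
    (d : ∀ j : Fin V.n, T.Idx (V.lab j)) (x : HalfEdge M'.I U.n V.n M'.nL M'.nR) :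
    T.halfVec M' u c d x ≍ T.halfVec M u (T.idxEquiv s c) d (s.onHalf x) := by
  rcases x with e | e | i | j | k | k
  · exact T.vec_heq (s.edgeLab_onI e).symm (T.idxEquiv_heq s c e)
  · exact T.covec_heq (s.edgeLab_onI e).symm (T.idxEquiv_heq s c e)
  -- Both families take the same `u` on the in-boundary, the same `d` on the out-boundary, and `1`
  -- on the sides.
  all_goals rfl

theorem flagVec_onFlag (u : ∀ i, T.edge (U.lab i)) (c : ∀ e : M'.I, T.Idx (M'.edgeLab e))
    (d : ∀ j : Fin V.n, T.Idx (V.lab j)) (f : M'.Flag) :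
    T.flagVec M' u c d f ≍ T.flagVec M u (T.idxEquiv s c) d (s.onFlag f) := by
  obtain ⟨x, rfl⟩ := M'.inc.surjective f
  refine (T.flagVec_inc M' u c d x).trans ((T.halfVec_onHalf s u c d x).trans ?_)
  rw [← s.inc_onHalf]
  exact (T.flagVec_inc M u _ d _).symm

/-- Two different pieces of one edge force that edge into a side, where `halfVec` is `1`. This
supplies the hypothesis `hs` of `evalFun_subCell`. -/
theorem flagVec_onFlag_eq_one (u : ∀ i, T.edge (U.lab i)) (c : ∀ e : M.I, T.Idx (M.edgeLab e))
    (d : ∀ j : Fin V.n, T.Idx (V.lab j)) {f g : M'.Flag} (hfg : f ≠ g)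
    (h : s.onFlag f = s.onFlag g) :
    T.flagVec M u c d (s.onFlag f) ≍ T.scalar.symm 1 := by
  obtain ⟨x, rfl⟩ := M'.inc.surjective f
  obtain ⟨y, rfl⟩ := M'.inc.surjective g
  rw [← s.inc_onHalf, ← s.inc_onHalf] at h
  rw [← s.inc_onHalf]
  refine (T.flagVec_inc M u c d _).trans ?_
  obtain ⟨k, hk⟩ | ⟨k, hk⟩ := HalfEdge.mapSides_eq_side s.onI.injective s.onLeft s.onRight
    (fun hxy => hfg (congrArg _ hxy)) (M.inc.injective h)
  · exact congr_arg_heq (T.halfVec M u c d) hk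
  · exact congr_arg_heq (T.halfVec M u c d) hk

theorem evalFlags_sideSubdivision (u : ∀ i, T.edge (U.lab i))
    (c : ∀ e : M'.I, T.Idx (M'.edgeLab e)) (d : ∀ j : Fin V.n, T.Idx (V.lab j)) :
    T.evalFlags M' (T.flagVec M' u c d) =
      T.evalFlags M (T.flagVec M u (T.idxEquiv s c) d) := by
  refine Fintype.prod_equiv s.onP _ _ fun p => ?_
  refine T.evalFun_subCell (s.subCell p) _ _ (fun e => T.flagVec_onFlag s u c d ⟨p, e⟩)
    fun e e' hne h => ?_
  refine T.flagVec_onFlag_eq_one s u _ d (f := ⟨p, e⟩) (g := ⟨p, e'⟩) ?_ ?_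
  · exact fun h => hne (eq_of_heq (Sigma.mk.inj h).2)
  · exact congrArg (Sigma.mk (s.onP p)) h

/-- Subdividing the sides does not change the value of the theory. -/
theorem onBordism_sideSubdivision (s : SideSubdivision M M') : T.onBordism M' = T.onBordism M := by
  classical
  refine PiTensorProduct.ext (MultilinearMap.ext fun u => ?_)
  simp only [LinearMap.compMultilinearMap_apply]
  rw [onBordism_tprod, onBordism_tprod]
  -- The interior edges correspond bijectively with equal labels, so both state sums run over the
  -- same states; the out-boundary is shared.
  refine Fintype.sum_equiv (T.idxEquiv s) _ _ fun c => ?_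
  simp only [T.evalFlags_sideSubdivision s]

end

end TrivialTheory

/-! ### Factorisation of the state sum of a fusion -/

namespace TrivialTheory

variable {D₂ D₁ D₀ : Type*} [Unique D₂] {D : DefectData D₂ D₁ D₀} (T : TrivialTheory D)

section

variable {U₁ V₁ U₂ V₂ : DefectArc D₁} (M₁ : CWBordism D U₁ V₁) (M₂ : CWBordism D U₂ V₂)
  (h : M₁.nR = M₂.nL)

/-- Basis indices at the interior edges of a fusion. The new interior edges meet no defect, so that
there is only one index for them. -/
def interiorIdxEquiv :
    ((∀ e : M₁.I, T.Idx (M₁.edgeLab e)) × ∀ e : M₂.I, T.Idx (M₂.edgeLab e)) ≃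
      ∀ e : (M₁.fuse M₂ h).I, T.Idx ((M₁.fuse M₂ h).edgeLab e) where
  toFun c
    | .inl (.inl e) => c.1 e
    | .inl (.inr e) => c.2 e
    | .inr _ => ()
  invFun c := (fun e => c (.inl (.inl e)), fun e => c (.inl (.inr e)))
  left_inv _ := rfl
  right_inv c := by
    funext e
    rcases e with (e | e) | k <;> rfl

/-- Basis indices at the edges of a fusion of objects. -/
def fuseIdxEquiv (V₁ V₂ : DefectArc D₁) :
    ((∀ j, T.Idx (V₁.lab j)) × ∀ j, T.Idx (V₂.lab j)) ≃ ∀ j, T.Idx ((V₁.fuse V₂).lab j) :=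
  (Equiv.sumPiEquivProdPi (fun j => T.Idx (Sum.elim V₁.lab V₂.lab j))).symm.trans
    (Equiv.piCongrLeft' _ finSumFinEquiv)

theorem vec_fuseIdxEquiv (d : (∀ j, T.Idx (V₁.lab j)) × ∀ j, T.Idx (V₂.lab j)) :
    (fun j => T.vec ((V₁.fuse V₂).lab j) (T.fuseIdxEquiv V₁ V₂ d j)) =
      T.fuseVec (fun j => T.vec (V₁.lab j) (d.1 j)) (fun j => T.vec (V₂.lab j) (d.2 j)) := by
  funext j
  -- Everything is expressed through `finSumFinEquiv.symm j`, so that splitting this one element of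
  -- the sum type decides both sides.
  change T.vec (Sum.elim V₁.lab V₂.lab (finSumFinEquiv.symm j))
    ((Equiv.sumPiEquivProdPi (fun j => T.Idx (Sum.elim V₁.lab V₂.lab j))).symm d
      (finSumFinEquiv.symm j)) = Sum.rec _ _ (finSumFinEquiv.symm j)
  rcases finSumFinEquiv.symm j with j | j <;> rfl

theorem fuseIdxEquiv_inl (d : (∀ j, T.Idx (V₁.lab j)) × ∀ j, T.Idx (V₂.lab j)) (j : Fin V₁.n) :
    T.fuseIdxEquiv V₁ V₂ d (finSumFinEquiv (.inl j)) ≍ d.1 j :=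
  congr_arg_heq ((Equiv.sumPiEquivProdPi (fun j => T.Idx (Sum.elim V₁.lab V₂.lab j))).symm d)
    (finSumFinEquiv.symm_apply_apply (.inl j))

theorem fuseIdxEquiv_inr (d : (∀ j, T.Idx (V₁.lab j)) × ∀ j, T.Idx (V₂.lab j)) (j : Fin V₂.n) :
    T.fuseIdxEquiv V₁ V₂ d (finSumFinEquiv (.inr j)) ≍ d.2 j :=
  congr_arg_heq ((Equiv.sumPiEquivProdPi (fun j => T.Idx (Sum.elim V₁.lab V₂.lab j))).symm d)
    (finSumFinEquiv.symm_apply_apply (.inr j))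

theorem _root_.DefectArc.fuse_lab_inl (V₁ V₂ : DefectArc D₁) (j : Fin V₁.n) :
    (V₁.fuse V₂).lab (finSumFinEquiv (.inl j)) = V₁.lab j :=
  congrArg (Sum.elim V₁.lab V₂.lab) (finSumFinEquiv.symm_apply_apply (.inl j))

theorem _root_.DefectArc.fuse_lab_inr (V₁ V₂ : DefectArc D₁) (j : Fin V₂.n) :
    (V₁.fuse V₂).lab (finSumFinEquiv (.inr j)) = V₂.lab j :=
  congrArg (Sum.elim V₁.lab V₂.lab) (finSumFinEquiv.symm_apply_apply (.inr j))

variable (u₁ : ∀ i, T.edge (U₁.lab i)) (u₂ : ∀ i, T.edge (U₂.lab i))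
  (c : (∀ e : M₁.I, T.Idx (M₁.edgeLab e)) × ∀ e : M₂.I, T.Idx (M₂.edgeLab e))
  (d : (∀ j, T.Idx (V₁.lab j)) × ∀ j, T.Idx (V₂.lab j))

/-- The polygons of the first piece see the same vectors before and after gluing. The only
half-edges that change kind are those of the right side. -/
theorem flagVec_fuse_inl (f : M₁.Flag) :
    T.flagVec (M₁.fuse M₂ h) (T.fuseVec u₁ u₂) (T.interiorIdxEquiv M₁ M₂ h c)
        (T.fuseIdxEquiv V₁ V₂ d) (M₁.flagInl M₂ h f) ≍ T.flagVec M₁ u₁ c.1 d.1 f := by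
  obtain ⟨x, rfl⟩ := M₁.inc.surjective f
  refine HEq.trans ?_ (T.flagVec_inc M₁ u₁ c.1 d.1 x).symm
  -- It is enough to name the half-edge `y` of the fusion that occupies the same flag and to compare
  -- the vectors there.
  have key : ∀ y, (M₁.fuse M₂ h).inc y = M₁.flagInl M₂ h (M₁.inc x) →
      T.halfVec (M₁.fuse M₂ h) (T.fuseVec u₁ u₂) (T.interiorIdxEquiv M₁ M₂ h c)
        (T.fuseIdxEquiv V₁ V₂ d) y ≍ T.halfVec M₁ u₁ c.1 d.1 x →
      T.flagVec (M₁.fuse M₂ h) (T.fuseVec u₁ u₂) (T.interiorIdxEquiv M₁ M₂ h c)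
        (T.fuseIdxEquiv V₁ V₂ d) (M₁.flagInl M₂ h (M₁.inc x)) ≍ T.halfVec M₁ u₁ c.1 d.1 x := by
    intro y hy hv
    rw [← hy]
    exact (T.flagVec_inc _ _ _ _ y).trans hv
  rcases x with e | e | i | j | k | k
  · exact key (.fst (.inl (.inl e))) rfl .rfl
  · exact key (.snd (.inl (.inl e))) rfl .rfl
  · exact key (.inn (finSumFinEquiv (.inl i))) (M₁.fuse_inc_inn_inl M₂ h i)
      (T.fuseVec_inl u₁ u₂ i)
  · exact key (.out (finSumFinEquiv (.inl j))) (M₁.fuse_inc_out_inl M₂ h j)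
      (T.covec_heq (V₁.fuse_lab_inl V₂ j) (T.fuseIdxEquiv_inl d j))
  · exact key (.left k) rfl .rfl
  · exact key (.fst (.inr k)) rfl .rfl

/-- The mirror image of `flagVec_fuse_inl`: here the left side is absorbed into new interior edges.
-/
theorem flagVec_fuse_inr (f : M₂.Flag) :
    T.flagVec (M₁.fuse M₂ h) (T.fuseVec u₁ u₂) (T.interiorIdxEquiv M₁ M₂ h c)
        (T.fuseIdxEquiv V₁ V₂ d) (M₁.flagInr M₂ h f) ≍ T.flagVec M₂ u₂ c.2 d.2 f := by
  obtain ⟨x, rfl⟩ := M₂.inc.surjective f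
  refine HEq.trans ?_ (T.flagVec_inc M₂ u₂ c.2 d.2 x).symm
  have key : ∀ y, (M₁.fuse M₂ h).inc y = M₁.flagInr M₂ h (M₂.inc x) →
      T.halfVec (M₁.fuse M₂ h) (T.fuseVec u₁ u₂) (T.interiorIdxEquiv M₁ M₂ h c)
        (T.fuseIdxEquiv V₁ V₂ d) y ≍ T.halfVec M₂ u₂ c.2 d.2 x →
      T.flagVec (M₁.fuse M₂ h) (T.fuseVec u₁ u₂) (T.interiorIdxEquiv M₁ M₂ h c)
        (T.fuseIdxEquiv V₁ V₂ d) (M₁.flagInr M₂ h (M₂.inc x)) ≍ T.halfVec M₂ u₂ c.2 d.2 x := by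
    intro y hy hv
    rw [← hy]
    exact (T.flagVec_inc _ _ _ _ y).trans hv
  rcases x with e | e | i | j | k | k
  · exact key (.fst (.inl (.inr e))) rfl .rfl
  · exact key (.snd (.inl (.inr e))) rfl .rfl
  · exact key (.inn (finSumFinEquiv (.inr i))) (M₁.fuse_inc_inn_inr M₂ h i)
      (T.fuseVec_inr u₁ u₂ i)
  · exact key (.out (finSumFinEquiv (.inr j))) (M₁.fuse_inc_out_inr M₂ h j)
      (T.covec_heq (V₁.fuse_lab_inr V₂ j) (T.fuseIdxEquiv_inr d j))
  · exact key (.snd (.inr (Fin.cast h.symm k))) rfl .rfl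
  · exact key (.right k) rfl .rfl

/-- The polygons of the fusion are the disjoint union of those of the two pieces, and each one is
evaluated on unchanged vectors. -/
theorem evalFlags_fuse :
    T.evalFlags (M₁.fuse M₂ h) (T.flagVec (M₁.fuse M₂ h) (T.fuseVec u₁ u₂)
        (T.interiorIdxEquiv M₁ M₂ h c) (T.fuseIdxEquiv V₁ V₂ d)) =
      T.evalFlags M₁ (T.flagVec M₁ u₁ c.1 d.1) * T.evalFlags M₂ (T.flagVec M₂ u₂ c.2 d.2) := by
  refine (Fintype.prod_sum_type _).trans (congrArg₂ (· * ·) ?_ ?_)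
  · exact Finset.prod_congr rfl fun p _ => congrArg (T.evalFun (M₁.cell p))
      (funext fun e => eq_of_heq (T.flagVec_fuse_inl M₁ M₂ h u₁ u₂ c d ⟨p, e⟩))
  · exact Finset.prod_congr rfl fun p _ => congrArg (T.evalFun (M₂.cell p))
      (funext fun e => eq_of_heq (T.flagVec_fuse_inr M₁ M₂ h u₁ u₂ c d ⟨p, e⟩))

/-- The value of the theory on a fusion of decomposed bordisms. -/
theorem onBordism_fuse :
    T.onBordism (M₁.fuse M₂ h) ∘ₗ (T.objFuse U₁ U₂).toLinearMap =
      (T.objFuse V₁ V₂).toLinearMap ∘ₗ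
        TensorProduct.map (T.onBordism M₁) (T.onBordism M₂) := by
  classical
  refine TensorProduct.ext (PiTensorProduct.ext (MultilinearMap.ext fun u₁ =>
    PiTensorProduct.ext (MultilinearMap.ext fun u₂ => ?_)))
  change T.onBordism (M₁.fuse M₂ h) (T.objFuse U₁ U₂
      (PiTensorProduct.tprod ℂ u₁ ⊗ₜ[ℂ] PiTensorProduct.tprod ℂ u₂)) =
    T.objFuse V₁ V₂ (T.onBordism M₁ (PiTensorProduct.tprod ℂ u₁) ⊗ₜ[ℂ]
      T.onBordism M₂ (PiTensorProduct.tprod ℂ u₂))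
  rw [T.objFuse_tmul_tprod, onBordism_tprod, onBordism_tprod, onBordism_tprod,
    -- The states of the fusion are rewritten as pairs of states, first at the interior edges and
    -- then at the out-edges.
    ← (T.interiorIdxEquiv M₁ M₂ h).sum_comp]
  simp only [← (T.fuseIdxEquiv V₁ V₂).sum_comp, vec_fuseIdxEquiv, evalFlags_fuse,
    Fintype.sum_prod_type, ← T.objFuse_tmul_tprod, TensorProduct.sum_tmul, TensorProduct.tmul_sum,
    map_sum, TensorProduct.smul_tmul_smul, map_smul]
  symm
  -- The summands now agree and only the order of summation differs: expanding the tensor product of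
  -- two sums gives the order c₂, d₂, c₁, d₁, while the fusion gives c₁, c₂, d₁, d₂.
  refine (Finset.sum_congr rfl fun c₂ _ => Finset.sum_comm).trans (Finset.sum_comm.trans ?_)
  exact Finset.sum_congr rfl fun c₁ _ => Finset.sum_congr rfl fun c₂ _ => Finset.sum_comm

end

end TrivialTheory

end

/-! ### The proposition -/

theorem mainTheorem10 {D₂ D₁ D₀ : Type*} [Unique D₂] (D : DefectData D₂ D₁ D₀)
    (T : TrivialTheory D) {U₁ V₁ U₂ V₂ : DefectArc D₁}
    (M₁ M₁' : PolygonalBordism D U₁ V₁) (M₂ M₂' : PolygonalBordism D U₂ V₂)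
    (s₁ : SideSubdivision M₁.toCWBordism M₁'.toCWBordism)
    (s₂ : SideSubdivision M₂.toCWBordism M₂'.toCWBordism)
    (h : M₁'.nR = M₂'.nL) :
    T.onBordism (M₁'.fuse M₂' h).toCWBordism ∘ₗ (T.objFuse U₁ U₂).toLinearMap =
      (T.objFuse V₁ V₂).toLinearMap ∘ₗ
        TensorProduct.map (T.onBordism M₁.toCWBordism) (T.onBordism M₂.toCWBordism) := by
  -- The fusion is formed from the subdivided bordisms, so the values on `M₁` and `M₂` are first
  -- replaced by those on `M₁'` and `M₂'`.
  rw [← T.onBordism_sideSubdivision s₁, ← T.onBordism_sideSubdivision s₂]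
  exact T.onBordism_fuse M₁'.toCWBordism M₂'.toCWBordism h
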